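/- Let $\mathcal X$ be a finite set. A transition matrix $W(x|\bar x)$ on $\mathcal X$ satisfies $W\ge 0$ and $\sum_x W(x|\bar x)=1$. It is irreducible if for all $x,\bar x$ some power $W^n$ with $n\ge1$ has $W^n(x|\bar x)>0$. It is ergodic if moreover there are no $\bar x$ and no integer $n'\ge 2$ such that $W^n(\bar x|\bar x)=0$ unless $n'\mid n$. For ergodic transition matrices $W,V$ with the same support, let $\varphi_{W,V}(1+s)$ be the logarithm of the Perron–Frobenius eigenvalue (spectral radius) of the matrix $W(x|\bar x)^{1+s}V(x|\bar x)^{-s}$ (zero off the support), and put $$D(W\|V):=\varphi_{W,V}'(1),\qquad D_{1+s}(W\|V):=\frac{\varphi_{W,V}(1+s)}{s}\ (s\ne0),\qquad D_1(W\|V):=D(W\|V).$$ Let $W_0,W_1$ be ergodic transition matrices on $\mathcal X$ with the same support, and let $g(x,\bar x)=\log\frac{W_1(x|\bar x)}{W_0(x|\bar x)}$ on that support. Let $\lambda_\theta$ be the Perron–Frobenius eigenvalue of $\tilde W_\theta(x|\bar x)=W_0(x|\bar x)e^{\theta g(x,\bar x)}$, let $\phi(\theta)=\log\lambda_\theta$,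 let $\hat P_\theta$ be a positive eigenvector of $\tilde W_\theta^T$ for $\lambda_\theta$, and let $W_\theta(x|\bar x)=\lambda_\theta^{-1}\hat P_\theta(x)\tilde W_\theta(x|\bar x)\hat P_\theta(\bar x)^{-1}$; this family passes through $W_0$ at $\theta=0$ and $W_1$ at $\theta=1$. Let $P_0,P_1$ be probability distributions on $\mathcal X$ whose supports intersect (for example, with equal supports). Let $W_i^{\times n}\times P_i$ be the law on $\mathcal X^{n+1}$ of the first $n+1$ states of the Markov chain with initial distribution $P_i$ and transition matrix $W_i$. For distributions $Q_0,Q_1$ on a finite set let $$\beta_\epsilon(Q_1\|Q_0)=\min_T\{\mathsf E_{Q_0}[1-T] : 0\le T\le 1,\ \mathsf E_{Q_1}[T]\le\epsilon\}$$ be the minimum second error probability, either over all randomized tests $T$ or over the deterministic tests $T=1_S$ only. Let $0<r\le D(W_0\|W_1)$. Then the equation $(\theta-1)\phi'(\theta)-\phi(\theta)=r$ has a smallest real solution $\hat\theta(r)$; it satisfies $0\le\hat\theta(r)<1$ and $D(W_{\hat\theta(r)}\|W_1)=r$. With either definition of $\beta_\epsilon$, $$\begin{aligned}\lim_{n\to\infty}-\frac1n\log\beta_{e^{-nr}}(W_1^{\times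 n}\times P_1\|W_0^{\times n}\times P_0) &=\sup_{0\le\theta<1}\frac{-\theta r-\phi(\theta)}{1-\theta} =\sup_{0\le\theta<1}\frac{\theta\,(-r+D_{1-\theta}(W_0\|W_1))}{1-\theta}\\ &=\inf_{s>0,\ \theta\in(\hat\theta(r),1)}D_{1+s}(W_\theta\|W_0) =D(W_{\hat\theta(r)}\|W_0) =\min_{W:\,D(W\|W_1)\le r}D(W\|W_0),\end{aligned}$$ where the last minimum is over the ergodic transition matrices $W$ with the same support as $W_0$ and $W_1$, and it is attained. -/

import Mathlib

open Filter Topology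
open scoped Matrix

noncomputable section

namespace MarkovHT

/-! Throughout, a transition matrix `W(x | y)` on a finite set `X` is a matrix whose row index is the
new state `x` and whose column index is the old state `y`; its columns sum to one. -/

/-- An irreducible and ergodic transition matrix: column-stochastic, irreducible, and there are no
state `x` and integer `d ≥ 2` such that `W ^ n (x | x) = 0` unless `d ∣ n`. -/
structure IsErgodicTransition {X : Type*} [Fintype X] [DecidableEq X] (W : Matrix X X ℝ) :
    Prop where
  stochastic : W ∈ Matrix.colStochastic ℝ X
  irreducible : W.IsIrreducible
  aperiodic : ¬ ∃ (x : X) (d : ℕ), 2 ≤ d ∧ ∀ n : ℕ, ¬ d ∣ n → (W ^ n) x x = 0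

/-- Two matrices have the same zero pattern. -/
def SameSupport {X : Type*} (W V : Matrix X X ℝ) : Prop :=
  ∀ x y, W x y = 0 ↔ V x y = 0

/-- The Perron-Frobenius eigenvalue of a non-negative square matrix: its (complex) spectral
radius. -/
def perronRoot {X : Type*} [Fintype X] [DecidableEq X] (A : Matrix X X ℝ) : ℝ :=
  (spectralRadius ℂ (A.map (fun a : ℝ => (a : ℂ)))).toReal

/-- A positive eigenvector of the transpose of `A` for the Perron-Frobenius eigenvalue. For an
irreducible non-negative matrix it exists and is unique up to a positive scalar. -/
def perronLeftVec {X : Type*} [Fintype X] [DecidableEq X] (A : Matrix X X ℝ) : X → ℝ :=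
  Classical.epsilon fun v : X → ℝ => (∀ x, 0 < v x) ∧ Aᵀ *ᵥ v = perronRoot A • v

/-- The function `φ(t)`, the logarithm of the Perron-Frobenius eigenvalue of the matrix
`W(x|y) ^ t * V(x|y) ^ (1 - t)`; the usual parameter is `t = 1 + s`. -/
def renyiPotential {X : Type*} [Fintype X] [DecidableEq X] (W V : Matrix X X ℝ) (t : ℝ) : ℝ :=
  Real.log (perronRoot (Matrix.of fun x y => W x y ^ t * V x y ^ (1 - t)))

/-- The relative entropy `D(W ‖ V)` of two transition matrices with the same support. -/
def relEntropy {X : Type*} [Fintype X] [DecidableEq X] (W V : Matrix X X ℝ) : ℝ :=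
  deriv (renyiPotential W V) 1

/-- The relative Rényi entropy `D_{1+s}(W ‖ V)`, with the continuous extension
`D_1(W ‖ V) = D(W ‖ V)` at `s = 0`. -/
def renyiRelEntropy {X : Type*} [Fintype X] [DecidableEq X] (s : ℝ) (W V : Matrix X X ℝ) : ℝ :=
  if s = 0 then relEntropy W V else renyiPotential W V (1 + s) / s

/-- The generator `g(x, y) = log (W₁(x|y) / W₀(x|y))`. It is only ever used multiplied by
`W₀(x|y)`, so that its values off the common support do not matter. -/
def logRatio {X : Type*} (W₀ W₁ : Matrix X X ℝ) (x y : X) : ℝ :=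
  Real.log (W₁ x y / W₀ x y)

/-- The tilted matrix `W(x|y) * exp (θ * g(x, y))`. -/
def tilted {X : Type*} (W : Matrix X X ℝ) (g : X → X → ℝ) (θ : ℝ) : Matrix X X ℝ :=
  Matrix.of fun x y => W x y * Real.exp (θ * g x y)

/-- The potential function `φ(θ)` of the exponential family generated by `g`. -/
def potential {X : Type*} [Fintype X] [DecidableEq X] (W : Matrix X X ℝ) (g : X → X → ℝ)
    (θ : ℝ) : ℝ :=
  Real.log (perronRoot (tilted W g θ))

/-- The exponential family of transition matrices through `W` with generator `g`. It does not depend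
on the normalization of the eigenvector. -/
def expFamily {X : Type*} [Fintype X] [DecidableEq X] (W : Matrix X X ℝ) (g : X → X → ℝ)
    (θ : ℝ) : Matrix X X ℝ :=
  Matrix.of fun x y =>
    (perronRoot (tilted W g θ))⁻¹ * perronLeftVec (tilted W g θ) x * tilted W g θ x y *
      (perronLeftVec (tilted W g θ) y)⁻¹

/-- The set of solutions `θ` of `(θ - 1) * φ'(θ) - φ(θ) = r`. -/
def thetaSolutions (φ : ℝ → ℝ) (r : ℝ) : Set ℝ :=
  {θ : ℝ | (θ - 1) * deriv φ θ - φ θ = r}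

/-- The smallest solution of `(θ - 1) * φ'(θ) - φ(θ) = r`. -/
def thetaHat (φ : ℝ → ℝ) (r : ℝ) : ℝ :=
  sInf (thetaSolutions φ r)

/-- The law `W^{×n} × P` of the first `n + 1` states of the Markov chain with initial
distribution `P` and transition matrix `W`. -/
def pathLaw {X : Type*} (W : Matrix X X ℝ) (P : X → ℝ) (n : ℕ) (x : Fin (n + 1) → X) : ℝ :=
  P (x 0) * ∏ i : Fin n, W (x i.succ) (x i.castSucc)

/-- `β_ε(Q₁ ‖ Q₀)`: the minimum of the second error probability `E_{Q₀}[1 - T]` over the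
randomized tests `T` whose first error probability `E_{Q₁}[T]` is at most `ε`. -/
def betaRandomized {Ω : Type*} [Fintype Ω] (ε : ℝ) (Q₁ Q₀ : Ω → ℝ) : ℝ :=
  sInf {b : ℝ | ∃ T : Ω → ℝ, (∀ ω, 0 ≤ T ω ∧ T ω ≤ 1) ∧
    ∑ ω, Q₁ ω * T ω ≤ ε ∧ b = ∑ ω, Q₀ ω * (1 - T ω)}

/-- The same minimum over the deterministic tests, given by their rejection region `S`:
the minimum of `1 - Q₀(S)` under the constraint `Q₁(S) ≤ ε`. -/
def betaDeterministic {Ω : Type*} [Fintype Ω] (ε : ℝ) (Q₁ Q₀ : Ω → ℝ) : ℝ :=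
  sInf {b : ℝ | ∃ S : Finset Ω, ∑ ω ∈ S, Q₁ ω ≤ ε ∧ b = 1 - ∑ ω ∈ S, Q₀ ω}

end MarkovHT

end

/-!
# The Hoeffding bound for Markov chains

Write `A θ` for the tilted matrix `W₀ * exp (θ * g)`, `φ θ` for the logarithm of its Perron
eigenvalue, and `u θ`, `v θ` for its positive left and right eigenvectors.

The analytic input is one inequality, `sum_mul_le_log_sub_log`: weighting the pairs `(x, y)` with
`u x * A x y * v y`, the mean of `k` is at most the increase of the logarithm of the Perron
eigenvalue when `A` is multiplied entrywise by `exp k`. It is `log z ≤ z - 1` for the ratio of two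
normalized transition matrices, whose coboundary part vanishes because both marginals of the weights
are proportional to `u * v`. It says that the tangents of `φ` lie below `φ`
(`potential_add_deriv_mul_le`), strictly unless `g` is a constant plus a coboundary, in which case
`φ` is affine; and, applied to an arbitrary transition matrix `W`, it gives
`(1 - θ) * D(W ‖ W₀) + θ * D(W ‖ W₁) ≥ -φ θ` (`neg_relEntropy_add_le_potential`). The derivative of
`φ` is computed in `hasDerivAt_potential` from the continuity of the normalized Perron vectors.

Conjugation by powers of `u θ` turns the Rényi potentials between `W θ` and `W₀` or `W₁` into
increments of `φ` (`renyiPotential_expFamily`); in particular `D(W θ ‖ W₁) = (θ - 1) * φ' θ - φ θ`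
and `D(W θ ‖ W₀) = θ * φ' θ - φ θ`. Since `φ 0 = φ 1 = 0` and `φ' 0 < 0`, the function `φ` is
strictly convex, and all the variational expressions for the exponent follow from its tangent at the
smallest solution of `(θ - 1) * φ' θ - φ θ = r`.

For the tests, a sum of products of powers of two path laws is a path sum of a nonnegative matrix,
so it is at most a constant times a power of its Perron eigenvalue (`exists_sum_pathLaw_rpow_le`).
With `Q₀ ^ (1 - θ) * Q₁ ^ θ` this bounds both errors of the likelihood ratio test
(`exists_betaDeterministic_le`). The converse (`eventually_le_betaRandomized`) is a change of measure
to `W θ` with `θ` slightly above the critical parameter: since `D(W θ ‖ W₁) < r`, the first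
constraint forces the test to accept under `W θ`, and then the second error probability is at least
about `exp (-n * D(W θ ‖ W₀))`.
-/

open Filter Topology
open scoped Matrix

namespace MarkovHT

/-! ### Perron–Frobenius theory of irreducible matrices -/

section Perron

variable {X : Type*} [Fintype X] {A : Matrix X X ℝ} {c : ℝ} {u v : X → ℝ}

/-- A positive left eigenvector `u` of `A` with eigenvalue `c`. -/
structure IsLeftPerron (A : Matrix X X ℝ) (c : ℝ) (u : X → ℝ) : Prop where
  pos : ∀ x, 0 < u x
  eigen : ∀ y, ∑ x, u x * A x y = c * u y

/-- A positive right eigenvector `v` of `A` with eigenvalue `c`. -/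
structure IsRightPerron (A : Matrix X X ℝ) (c : ℝ) (v : X → ℝ) : Prop where
  pos : ∀ x, 0 < v x
  eigen : ∀ x, ∑ y, A x y * v y = c * v x

lemma IsRightPerron.transpose (h : IsRightPerron Aᵀ c v) : IsLeftPerron A c v :=
  ⟨h.pos, fun y => by simpa [mul_comm] using h.eigen y⟩

/-- The second marginal of the weights `u x * A x y * v y` is `c * u * v`, for every `v`. -/
lemma IsLeftPerron.sum_sum (hu : IsLeftPerron A c u) (f : X → ℝ) :
    ∑ x, ∑ y, u x * A x y * v y * f y = c * ∑ y, u y * v y * f y := by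
  rw [Finset.sum_comm, Finset.mul_sum]
  refine Finset.sum_congr rfl fun y _ => ?_
  rw [show c * (u y * v y * f y) = (c * u y) * (v y * f y) by ring, ← hu.eigen, Finset.sum_mul]
  exact Finset.sum_congr rfl fun x _ => by ring

/-- The first marginal of the weights `u x * A x y * v y` is `c * u * v`, for every `u`. -/
lemma IsRightPerron.sum_sum (hv : IsRightPerron A c v) (f : X → ℝ) :
    ∑ x, ∑ y, u x * A x y * v y * f x = c * ∑ x, u x * v x * f x := by
  rw [Finset.mul_sum]
  refine Finset.sum_congr rfl fun x _ => ?_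
  rw [show c * (u x * v x * f x) = u x * f x * (c * v x) by ring, ← hv.eigen, Finset.mul_sum]
  exact Finset.sum_congr rfl fun y _ => by ring

lemma IsLeftPerron.sum_pos [Nonempty X] (hu : IsLeftPerron A c u) (hv : ∀ x, 0 < v x) :
    0 < ∑ x, u x * v x :=
  Finset.sum_pos (fun x _ => mul_pos (hu.pos x) (hv x)) Finset.univ_nonempty

/-- Pairing with a positive right eigenvector shows that all positive eigenvectors share their
eigenvalue. -/
lemma IsLeftPerron.eigenvalue_eq [Nonempty X] {c' : ℝ} (hu : IsLeftPerron A c u)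
    (hv : IsRightPerron A c' v) : c = c' := by
  have h1 := hu.sum_sum (v := v) fun _ => 1
  have h2 := hv.sum_sum (u := u) fun _ => 1
  simp only [mul_one] at h1 h2
  exact mul_right_cancel₀ (hu.sum_pos hv.pos).ne' (h1.symm.trans h2)

/-- **Variational inequality.** With the weights `w x y = u x * A x y * v y` given by the Perron
vectors of `A`, the `w`-average of `k` is at most the increase of the logarithm of the Perron
eigenvalue from `A` to `A x y * exp (k x y)`. This is the inequality `log z ≤ z - 1` for the ratio
of the two normalized transition matrices. -/
lemma sum_mul_le_log_sub_log [Nonempty X] {c' : ℝ} {u' : X → ℝ} {k : X → X → ℝ}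
    (hA : ∀ x y, 0 ≤ A x y) (hc : 0 < c) (hc' : 0 < c')
    (hu : IsLeftPerron A c u) (hv : IsRightPerron A c v)
    (hu' : IsLeftPerron (Matrix.of fun x y => A x y * Real.exp (k x y)) c' u') :
    ∑ x, ∑ y, u x * A x y * v y * k x y ≤ (Real.log c' - Real.log c) * (c * ∑ x, u x * v x) ∧
    ((∃ x y, A x y ≠ 0 ∧
        k x y ≠ (Real.log c' - Real.log c) + Real.log (u x / u' x) - Real.log (u y / u' y)) →
      ∑ x, ∑ y, u x * A x y * v y * k x y <
        (Real.log c' - Real.log c) * (c * ∑ x, u x * v x)) := by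
  set L := Real.log c' - Real.log c with hL
  set f : X → ℝ := fun x => Real.log (u x / u' x) with hf
  have hz : ∀ x y, Real.exp (k x y - L - f x + f y) =
      Real.exp (k x y) * c * (u' x / u x) * (u y / u' y) / c' := by
    intro x y
    have h1 := hu.pos x; have h2 := hu'.pos x; have h3 := hu.pos y; have h4 := hu'.pos y
    rw [Real.exp_add, Real.exp_sub, Real.exp_sub, hL, Real.exp_sub, hf, Real.exp_log hc,
      Real.exp_log hc', Real.exp_log (by positivity), Real.exp_log (by positivity)]
    field_simp
  have hsum : ∑ x, ∑ y, u x * A x y * v y * Real.exp (k x y - L - f x + f y) =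
      c * ∑ x, u x * v x := by
    have h := hu'.sum_sum (v := fun y => c / c' * (u y * v y / u' y)) fun _ => 1
    simp only [Matrix.of_apply, mul_one] at h
    calc _ = ∑ x, ∑ y, u' x * (A x y * Real.exp (k x y)) * (c / c' * (u y * v y / u' y)) := by
          refine Finset.sum_congr rfl fun x _ => Finset.sum_congr rfl fun y _ => ?_
          rw [hz]
          have h1 := hu.pos x; have h4 := hu'.pos y
          field_simp
      _ = _ := by
          rw [h, Finset.mul_sum, Finset.mul_sum]
          refine Finset.sum_congr rfl fun y _ => ?_
          have h4 := hu'.pos y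
          field_simp
  have hw : ∀ x y, 0 ≤ u x * A x y * v y := fun x y =>
    mul_nonneg (mul_nonneg (hu.pos x).le (hA x y)) (hv.pos y).le
  have h1 := hu.sum_sum (v := v) f
  have h2 := hv.sum_sum (u := u) f
  have h3 : ∑ x, ∑ y, u x * A x y * v y = c * ∑ x, u x * v x := by
    simpa using hu.sum_sum (v := v) fun _ => 1
  have h4 : ∑ x, ∑ y, u x * A x y * v y * L = L * (c * ∑ x, u x * v x) := by
    rw [mul_comm L, ← h3]
    simp only [Finset.sum_mul]
  have key : (L * (c * ∑ x, u x * v x)) - ∑ x, ∑ y, u x * A x y * v y * k x y =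
      ∑ x, ∑ y, u x * A x y * v y *
        (Real.exp (k x y - L - f x + f y) - ((k x y - L - f x + f y) + 1)) := by
    simp only [mul_sub, mul_add, Finset.sum_sub_distrib, Finset.sum_add_distrib, mul_one, h1, h2,
      hsum, h3, h4]
    ring
  have hnn : ∀ x y, 0 ≤ u x * A x y * v y *
        (Real.exp (k x y - L - f x + f y) - ((k x y - L - f x + f y) + 1)) := fun x y =>
    mul_nonneg (hw x y) (sub_nonneg.2 (Real.add_one_le_exp _))
  refine ⟨?_, ?_⟩
  · rw [← sub_nonneg, key]
    exact Finset.sum_nonneg fun x _ => Finset.sum_nonneg fun y _ => hnn x y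
  · rintro ⟨x, y, hxy, hne⟩
    rw [← sub_pos, key]
    refine Finset.sum_pos' (fun x _ => Finset.sum_nonneg fun y _ => hnn x y)
      ⟨x, Finset.mem_univ x, Finset.sum_pos' (fun y _ => hnn x y) ⟨y, Finset.mem_univ y, ?_⟩⟩
    refine mul_pos (mul_pos (mul_pos (hu.pos x) ((hA x y).lt_of_ne' hxy)) (hv.pos y))
      (sub_pos.2 (Real.add_one_lt_exp fun h0 => hne ?_))
    linear_combination h0

variable [DecidableEq X]

/-- A nonnegative vector that an irreducible matrix increases at most by a constant factor has full
support. -/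
lemma pos_of_mulVec_le (hA : A.IsIrreducible) (hv : ∀ x, 0 ≤ v x) (hv0 : ∃ x, v x ≠ 0)
    (h : ∀ x, (A *ᵥ v) x ≤ c * v x) (x : X) : 0 < v x := by
  have hpow : ∀ k x, ((A ^ k) *ᵥ v) x ≤ |c| ^ k * v x := by
    intro k
    induction k with
    | zero => simp
    | succ k ih =>
      intro x
      rw [pow_succ', ← Matrix.mulVec_mulVec]
      calc (A *ᵥ (A ^ k *ᵥ v)) x ≤ ∑ y, A x y * (|c| ^ k * v y) :=
            Finset.sum_le_sum fun y _ => mul_le_mul_of_nonneg_left (ih y) (hA.nonneg x y)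
        _ = |c| ^ k * (A *ᵥ v) x := by
            simp only [Matrix.mulVec, dotProduct, Finset.mul_sum]
            exact Finset.sum_congr rfl fun y _ => by ring
        _ ≤ |c| ^ k * (|c| * v x) := by
            gcongr
            exact (h x).trans (mul_le_mul_of_nonneg_right (le_abs_self c) (hv x))
        _ = |c| ^ (k + 1) * v x := by ring
  obtain ⟨y, hy⟩ := hv0
  obtain ⟨k, -, hk⟩ := (Matrix.isIrreducible_iff_exists_pow_pos hA.nonneg).1 hA x y
  have h1 : 0 < ((A ^ k) *ᵥ v) x :=
    Finset.sum_pos' (fun z _ => mul_nonneg (Matrix.pow_apply_nonneg hA.nonneg k x z) (hv z))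
      ⟨y, Finset.mem_univ y, mul_pos hk ((hv y).lt_of_ne' hy)⟩
  exact pos_of_mul_pos_right (h1.trans_le (hpow k x)) (by positivity)

/-- The sum of suitable powers of `A`, one for each pair of states. -/
lemma exists_commute_pos (hA : A.IsIrreducible) :
    ∃ B : Matrix X X ℝ, Commute A B ∧ ∀ x y, 0 < B x y := by
  choose k _ hk using (Matrix.isIrreducible_iff_exists_pow_pos hA.nonneg).1 hA
  refine ⟨∑ x, ∑ y, A ^ k x y, ?_, fun x y => ?_⟩
  · exact Commute.sum_right _ _ _ fun x _ => Commute.sum_right _ _ _ fun y _ =>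
      (Commute.refl A).pow_right _
  · have hn : ∀ n, 0 ≤ (A ^ n) x y := fun n => Matrix.pow_apply_nonneg hA.nonneg n x y
    simp only [Matrix.sum_apply]
    exact Finset.sum_pos' (fun a _ => Finset.sum_nonneg fun b _ => hn _) ⟨x, Finset.mem_univ x,
      Finset.sum_pos' (fun b _ => hn _) ⟨y, Finset.mem_univ y, hk x y⟩⟩

/-- Existence of the Perron vector: among the probability vectors `v` with `A v ≤ c v`, one with the
least `c` is an eigenvector, since otherwise multiplication by a positive matrix that commutes with
`A` makes all the inequalities strict. -/
lemma exists_isRightPerron [Nonempty X] (hA : A.IsIrreducible) :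
    ∃ c v, IsRightPerron A c v := by
  set C : ℝ := ∑ x, ∑ y, A x y with hC
  set K : Set ((X → ℝ) × ℝ) :=
    (stdSimplex ℝ X ×ˢ Set.Icc 0 C) ∩ {p | ∀ x, (A *ᵥ p.1) x ≤ p.2 * p.1 x} with hK
  have hKc : IsCompact K := by
    refine ((isCompact_stdSimplex ℝ X).prod isCompact_Icc).inter_right ?_
    simp only [Set.ofPred_forall]
    refine isClosed_iInter fun x => isClosed_le ?_ (by fun_prop)
    simp only [Matrix.mulVec, dotProduct]
    fun_prop
  have hN : (0 : ℝ) < Fintype.card X := by exact_mod_cast Fintype.card_pos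
  have hKn : K.Nonempty := by
    refine ⟨(fun _ => (Fintype.card X : ℝ)⁻¹, C), ⟨⟨⟨fun _ => by positivity, ?_⟩, ?_, le_rfl⟩, ?_⟩⟩
    · simp [hN.ne']
    · exact Finset.sum_nonneg fun x _ => Finset.sum_nonneg fun y _ => hA.nonneg x y
    · intro x
      simp only [Matrix.mulVec, dotProduct, ← Finset.sum_mul]
      gcongr
      exact Finset.single_le_sum (f := fun x => ∑ y, A x y)
        (fun x _ => Finset.sum_nonneg fun y _ => hA.nonneg x y) (Finset.mem_univ x)
  obtain ⟨⟨v, c⟩, ⟨⟨hv, hc0, hcC⟩, hle⟩, hmin⟩ :=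
    hKc.exists_isMinOn hKn continuous_snd.continuousOn
  simp only at hc0 hcC hle hv
  have hv0 : ∃ x, v x ≠ 0 := by
    by_contra! h
    simpa [h] using hv.2
  have hvpos := pos_of_mulVec_le hA hv.1 hv0 hle
  refine ⟨c, v, hvpos, ?_⟩
  by_contra! hne
  obtain ⟨z, hz⟩ := hne
  have hz : (A *ᵥ v) z < c * v z := lt_of_le_of_ne (hle z) hz
  obtain ⟨B, hAB, hB⟩ := exists_commute_pos hA
  set w := B *ᵥ v with hw
  have hwpos : ∀ x, 0 < w x := fun x =>
    Finset.sum_pos (fun y _ => mul_pos (hB x y) (hvpos y)) Finset.univ_nonempty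
  have hlt : ∀ x, (A *ᵥ w) x < c * w x := by
    intro x
    rw [hw, Matrix.mulVec_mulVec, hAB.eq, ← Matrix.mulVec_mulVec]
    have : c * (B *ᵥ v) x = ∑ y, B x y * (c * v y) := by
      simp only [Matrix.mulVec, dotProduct, Finset.mul_sum]
      exact Finset.sum_congr rfl fun y _ => by ring
    rw [this]
    exact Finset.sum_lt_sum (fun y _ => mul_le_mul_of_nonneg_left (hle y) (hB x y).le)
      ⟨z, Finset.mem_univ z, mul_lt_mul_of_pos_left hz (hB x z)⟩
  -- the best constant for `w` is the largest of the ratios `(A w) x / w x`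
  obtain ⟨m, -, hm⟩ := Finset.exists_max_image Finset.univ (fun x => (A *ᵥ w) x / w x)
    Finset.univ_nonempty
  set d := (A *ᵥ w) m / w m with hd
  have hdc : d < c := (div_lt_iff₀ (hwpos m)).2 (hlt m)
  have hd0 : 0 ≤ d := div_nonneg
    (Finset.sum_nonneg fun y _ => mul_nonneg (hA.nonneg m y) (hwpos y).le) (hwpos m).le
  have hS : 0 < ∑ x, w x := Finset.sum_pos (fun x _ => hwpos x) Finset.univ_nonempty
  have hmem : ((∑ x, w x)⁻¹ • w, d) ∈ K := by
    refine ⟨⟨⟨fun x => ?_, ?_⟩, hd0, hdc.le.trans hcC⟩, fun x => ?_⟩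
    · exact mul_nonneg (inv_nonneg.2 hS.le) (hwpos x).le
    · simp [← Finset.mul_sum, hS.ne']
    · have := (div_le_iff₀ (hwpos x)).1 (hm x (Finset.mem_univ x))
      simp only [Matrix.mulVec_smul, Pi.smul_apply, smul_eq_mul]
      calc (∑ x, w x)⁻¹ * (A *ᵥ w) x ≤ (∑ x, w x)⁻¹ * (d * w x) := by gcongr
        _ = _ := by ring
  exact absurd (hmin hmem) (not_le.2 hdc)

lemma exists_isLeftPerron [Nonempty X] (hA : A.IsIrreducible) : ∃ c u, IsLeftPerron A c u := by
  obtain ⟨c, v, h⟩ := exists_isRightPerron hA.transpose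
  exact ⟨c, v, h.transpose⟩

lemma IsRightPerron.eigenvalue_pos [Nonempty X] (hA : A.IsIrreducible)
    (hv : IsRightPerron A c v) : 0 < c := by
  obtain ⟨x⟩ := ‹Nonempty X›
  have h0 : 0 ≤ c * v x := by
    rw [← hv.eigen]
    exact Finset.sum_nonneg fun y _ => mul_nonneg (hA.nonneg x y) (hv.pos y).le
  refine (nonneg_of_mul_nonneg_left h0 (hv.pos x)).lt_of_ne fun hc => ?_
  have hz : ∀ x y, A x y = 0 := by
    intro x y
    have h := hv.eigen x
    rw [← hc, zero_mul, Finset.sum_eq_zero_iff_of_nonneg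
      fun y _ => mul_nonneg (hA.nonneg x y) (hv.pos y).le] at h
    exact (mul_eq_zero.1 (h y (Finset.mem_univ y))).resolve_right (hv.pos y).ne'
  obtain ⟨k, hk, hpos⟩ := (Matrix.isIrreducible_iff_exists_pow_pos hA.nonneg).1 hA x x
  have : A = 0 := Matrix.ext hz
  simp [this, hk.ne'] at hpos

/-- The eigenvalue of a positive left eigenvector `u` is the spectral radius: it is an eigenvalue,
and the norm `∑ x, u x * ‖z x‖` bounds all the others by it. -/
lemma IsLeftPerron.perronRoot_eq [Nonempty X] (hA : ∀ x y, 0 ≤ A x y) (hc : 0 ≤ c)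
    (hu : IsLeftPerron A c u) : perronRoot A = c := by
  set M : Matrix X X ℂ := A.map (fun a : ℝ => (a : ℂ)) with hM
  have hspec : ∀ μ : ℂ, μ ∈ spectrum ℂ M ↔ (algebraMap ℂ (Matrix X X ℂ) μ - M).det = 0 := by
    intro μ
    rw [spectrum.mem_iff, Matrix.isUnit_iff_isUnit_det, isUnit_iff_ne_zero, not_not]
  have hmem : (c : ℂ) ∈ spectrum ℂ M := by
    rw [hspec, ← Matrix.exists_vecMul_eq_zero_iff]
    refine ⟨fun x => (u x : ℂ), ?_, ?_⟩
    · obtain ⟨x⟩ := ‹Nonempty X›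
      intro h
      have := congrFun h x
      simp [(hu.pos x).ne'] at this
    · ext y
      rw [Matrix.vecMul_sub, Algebra.algebraMap_eq_smul_one, Matrix.vecMul_smul, Matrix.vecMul_one]
      have : ((∑ x, u x * A x y : ℝ) : ℂ) = ((c * u y : ℝ) : ℂ) := by rw [hu.eigen]
      push_cast at this
      simp [Matrix.vecMul, dotProduct, hM, this]
  have hle : ∀ μ ∈ spectrum ℂ M, ‖μ‖ ≤ c := by
    intro μ hμ
    rw [hspec, ← Matrix.exists_mulVec_eq_zero_iff] at hμ
    obtain ⟨z, hz0, hz⟩ := hμ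
    rw [Matrix.sub_mulVec, Algebra.algebraMap_eq_smul_one, Matrix.smul_mulVec, Matrix.one_mulVec,
      sub_eq_zero] at hz
    have hpos : 0 < ∑ x, u x * ‖z x‖ := by
      obtain ⟨x, hx⟩ := Function.ne_iff.1 hz0
      exact Finset.sum_pos' (fun x _ => mul_nonneg (hu.pos x).le (norm_nonneg _))
        ⟨x, Finset.mem_univ x, mul_pos (hu.pos x) (norm_pos_iff.2 hx)⟩
    refine le_of_mul_le_mul_right ?_ hpos
    calc ‖μ‖ * ∑ x, u x * ‖z x‖ = ∑ x, u x * ‖(M *ᵥ z) x‖ := by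
          rw [← hz, Finset.mul_sum]
          refine Finset.sum_congr rfl fun x _ => ?_
          simp
          ring
      _ ≤ ∑ x, u x * ∑ y, A x y * ‖z y‖ := by
          refine Finset.sum_le_sum fun x _ => mul_le_mul_of_nonneg_left ?_ (hu.pos x).le
          refine (norm_sum_le _ _).trans (Finset.sum_le_sum fun y _ => ?_)
          simp [hM, abs_of_nonneg (hA x y)]
      _ = ∑ x, ∑ y, u x * A x y * ‖z y‖ * 1 := by
          refine Finset.sum_congr rfl fun x _ => ?_
          rw [Finset.mul_sum]
          exact Finset.sum_congr rfl fun y _ => by ring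
      _ = c * ∑ x, u x * ‖z x‖ := by
          simpa using hu.sum_sum (v := fun x => ‖z x‖) fun _ => 1
  have : spectralRadius ℂ M = ENNReal.ofReal c := by
    apply le_antisymm
    · refine iSup₂_le fun μ hμ => ?_
      exact ENNReal.coe_le_coe.2 (NNReal.coe_le_coe.1 (by simpa [hc] using hle μ hμ))
    · refine le_trans (le_of_eq ?_) (le_iSup₂ (f := fun (k : ℂ) (_ : k ∈ spectrum ℂ M) =>
        (‖k‖₊ : ENNReal)) (c : ℂ) hmem)
      rw [ENNReal.ofReal, ENNReal.coe_inj]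
      ext
      simp [hc, abs_of_nonneg]
  rw [perronRoot, this, ENNReal.toReal_ofReal hc]

lemma perronRoot_pos [Nonempty X] (hA : A.IsIrreducible) : 0 < perronRoot A := by
  obtain ⟨c, v, hv⟩ := exists_isRightPerron hA
  obtain ⟨d, u, hu⟩ := exists_isLeftPerron hA
  have hc := hv.eigenvalue_pos hA
  obtain rfl := hu.eigenvalue_eq hv
  rwa [hu.perronRoot_eq hA.nonneg hc.le]

lemma exists_isRightPerron_perronRoot [Nonempty X] (hA : A.IsIrreducible) :
    ∃ v, IsRightPerron A (perronRoot A) v := by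
  obtain ⟨c, v, hv⟩ := exists_isRightPerron hA
  obtain ⟨d, u, hu⟩ := exists_isLeftPerron hA
  have hc := hv.eigenvalue_pos hA
  obtain rfl := hu.eigenvalue_eq hv
  exact ⟨v, by rwa [hu.perronRoot_eq hA.nonneg hc.le]⟩

lemma isLeftPerron_perronLeftVec [Nonempty X] (hA : A.IsIrreducible) :
    IsLeftPerron A (perronRoot A) (perronLeftVec A) := by
  obtain ⟨c, v, hv⟩ := exists_isRightPerron hA
  obtain ⟨d, u, hu⟩ := exists_isLeftPerron hA
  have hc := hv.eigenvalue_pos hA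
  obtain rfl := hu.eigenvalue_eq hv
  have hex : ∃ v : X → ℝ, (∀ x, 0 < v x) ∧ Aᵀ *ᵥ v = perronRoot A • v := by
    refine ⟨u, hu.pos, ?_⟩
    ext y
    simpa [Matrix.mulVec, dotProduct, mul_comm, hu.perronRoot_eq hA.nonneg hc.le] using hu.eigen y
  have h := Classical.epsilon_spec hex
  refine ⟨h.1, fun y => ?_⟩
  simp only [mul_comm (perronLeftVec A _)]
  exact congrFun h.2 y

/-- A nonnegative eigenvector for the eigenvalue of a positive one is proportional to it: subtract
the largest multiple that leaves a nonnegative vector. -/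
lemma IsRightPerron.eq_of_mem_stdSimplex [Nonempty X] (hA : A.IsIrreducible)
    (hv : IsRightPerron A c v) (hvs : v ∈ stdSimplex ℝ X) {w : X → ℝ} (hw : w ∈ stdSimplex ℝ X)
    (hwe : ∀ x, ∑ y, A x y * w y = c * w x) : w = v := by
  obtain ⟨m, -, hm⟩ := Finset.exists_min_image Finset.univ (fun x => w x / v x)
    Finset.univ_nonempty
  set t := w m / v m with ht
  have hz : ∀ x, w x - t * v x = 0 := by
    by_contra! hne
    have h := pos_of_mulVec_le (c := c) hA (v := fun x => w x - t * v x)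
      (fun x => sub_nonneg.2 ((le_div_iff₀ (hv.pos x)).1 (hm x (Finset.mem_univ x)))) hne
      (fun x => le_of_eq ?_) m
    · rw [ht, div_mul_cancel₀ _ (hv.pos m).ne', sub_self] at h
      exact h.false
    · calc ∑ y, A x y * (w y - t * v y) = ∑ y, A x y * w y - t * ∑ y, A x y * v y := by
            rw [Finset.mul_sum, ← Finset.sum_sub_distrib]
            exact Finset.sum_congr rfl fun y _ => by ring
        _ = c * (w x - t * v x) := by rw [hwe, hv.eigen]; ring
  have h1 : t = 1 := by
    have := hw.2
    rw [Finset.sum_congr rfl fun x _ => sub_eq_zero.1 (hz x), ← Finset.mul_sum, hvs.2] at this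
    simpa using this
  ext x
  have := hz x
  rw [h1] at this
  linarith

end Perron

/-! ### The potential of an exponential family -/

section Support

variable {X : Type*} {A B : Matrix X X ℝ} {g : X → X → ℝ}

lemma SameSupport.pos_iff (hA : ∀ x y, 0 ≤ A x y) (hB : ∀ x y, 0 ≤ B x y) (h : SameSupport A B)
    (x y : X) : 0 < A x y ↔ 0 < B x y := by
  rw [(hA x y).lt_iff_ne', (hB x y).lt_iff_ne', ne_eq, ne_eq, h x y]

lemma SameSupport.toQuiver_eq (hA : ∀ x y, 0 ≤ A x y) (hB : ∀ x y, 0 ≤ B x y)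
    (h : SameSupport A B) : A.toQuiver = B.toQuiver := by
  unfold Matrix.toQuiver
  congr 1
  ext x y
  rw [h.pos_iff hA hB]

lemma SameSupport.symm (h : SameSupport A B) : SameSupport B A := fun x y => (h x y).symm

lemma SameSupport.isIrreducible (h : SameSupport A B) (hA : A.IsIrreducible)
    (hB : ∀ x y, 0 ≤ B x y) : B.IsIrreducible :=
  ⟨hB, h.toQuiver_eq hA.nonneg hB ▸ hA.connected⟩

lemma tilted_apply (θ : ℝ) (x y : X) : tilted B g θ x y = B x y * Real.exp (θ * g x y) := rfl

lemma sameSupport_tilted (θ : ℝ) : SameSupport B (tilted B g θ) := fun x y => by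
  simp [tilted_apply, Real.exp_ne_zero]

lemma tilted_zero : tilted B g 0 = B := by
  ext x y
  simp [tilted_apply]

lemma tilted_eq_of_mul_exp (a b : ℝ) :
    tilted B g b = Matrix.of fun x y => tilted B g a x y * Real.exp ((b - a) * g x y) := by
  ext x y
  rw [Matrix.of_apply, tilted_apply, tilted_apply, mul_assoc, ← Real.exp_add]
  ring_nf

lemma isIrreducible_tilted (hB : B.IsIrreducible) (θ : ℝ) : (tilted B g θ).IsIrreducible :=
  (sameSupport_tilted θ).isIrreducible hB fun x y =>
    mul_nonneg (hB.nonneg x y) (Real.exp_pos _).le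

end Support

section Potential

variable {X : Type*} [Fintype X] [DecidableEq X] {A B : Matrix X X ℝ} {g : X → X → ℝ}

/-- The zero pattern of a nonnegative matrix determines that of its powers. -/
lemma SameSupport.pow_eq_zero_iff (h : SameSupport A B) (hA : ∀ x y, 0 ≤ A x y)
    (hB : ∀ x y, 0 ≤ B x y) (n : ℕ) (x y : X) : (A ^ n) x y = 0 ↔ (B ^ n) x y = 0 := by
  rw [← not_iff_not, ← ne_eq, ← ne_eq, ← (Matrix.pow_apply_nonneg hA n x y).lt_iff_ne',
    ← (Matrix.pow_apply_nonneg hB n x y).lt_iff_ne', Matrix.pow_apply_pos_iff_nonempty_path hA,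
    Matrix.pow_apply_pos_iff_nonempty_path hB, h.toQuiver_eq hA hB]

/-- Irreducibility and aperiodicity depend only on the zero pattern. -/
lemma IsErgodicTransition.of_sameSupport (hA : IsErgodicTransition A) (h : SameSupport A B)
    (hB : B ∈ Matrix.colStochastic ℝ X) : IsErgodicTransition B := by
  have hBn : ∀ x y, 0 ≤ B x y := fun x y => Matrix.nonneg_of_mem_colStochastic hB
  refine ⟨hB, h.isIrreducible hA.irreducible hBn, fun ⟨x, d, hd, hx⟩ => hA.aperiodic
    ⟨x, d, hd, fun n hn => ?_⟩⟩
  exact (h.pow_eq_zero_iff hA.irreducible.nonneg hBn n x x).2 (hx n hn)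

variable [Nonempty X]

lemma exp_potential (hB : B.IsIrreducible) (θ : ℝ) :
    Real.exp (potential B g θ) = perronRoot (tilted B g θ) :=
  Real.exp_log (perronRoot_pos (isIrreducible_tilted hB θ))

lemma exists_isRightPerron_mem_stdSimplex (hA : A.IsIrreducible) :
    ∃ v ∈ stdSimplex ℝ X, IsRightPerron A (perronRoot A) v := by
  obtain ⟨v, hv⟩ := exists_isRightPerron_perronRoot hA
  have hS : 0 < ∑ x, v x := Finset.sum_pos (fun x _ => hv.pos x) Finset.univ_nonempty
  refine ⟨(∑ x, v x)⁻¹ • v, ⟨fun x => ?_, ?_⟩, fun x => ?_, fun x => ?_⟩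
  · exact mul_nonneg (inv_nonneg.2 hS.le) (hv.pos x).le
  · simp [← Finset.mul_sum, hS.ne']
  · exact mul_pos (inv_pos.2 hS) (hv.pos x)
  · simp only [Pi.smul_apply, smul_eq_mul, mul_left_comm _ (∑ x, v x)⁻¹, ← Finset.mul_sum,
      hv.eigen]

/-- The potential is Lipschitz: its increments are bounded below by averages of the increments of
the exponent. -/
lemma potential_sub_le (hB : B.IsIrreducible) (a b : ℝ) :
    potential B g a - potential B g b ≤ (∑ x, ∑ y, |g x y|) * |b - a| := by
  have hA := isIrreducible_tilted (g := g) hB a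
  have hρ := perronRoot_pos hA
  have hu := isLeftPerron_perronLeftVec hA
  obtain ⟨v, hv⟩ := exists_isRightPerron_perronRoot hA
  have hu' := isLeftPerron_perronLeftVec (isIrreducible_tilted (g := g) hB b)
  have hρ' := perronRoot_pos (isIrreducible_tilted (g := g) hB b)
  set ub := perronLeftVec (tilted B g b)
  set ρb := perronRoot (tilted B g b)
  rw [tilted_eq_of_mul_exp a b] at hu'
  have h := (sum_mul_le_log_sub_log hA.nonneg hρ hρ' hu hv hu').1
  set u := perronLeftVec (tilted B g a)
  set C := ∑ x, ∑ y, |g x y| with hC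
  have hpos := mul_pos hρ (hu.sum_pos hv.pos)
  have hsum : ∑ x, ∑ y, u x * tilted B g a x y * v y = perronRoot (tilted B g a) * ∑ x, u x * v x :=
    by simpa using hu.sum_sum (v := v) fun _ => 1
  have hlow : -(C * |b - a|) * (perronRoot (tilted B g a) * ∑ x, u x * v x) ≤
      ∑ x, ∑ y, u x * tilted B g a x y * v y * ((b - a) * g x y) := by
    rw [← hsum, mul_comm]
    simp only [Finset.sum_mul]
    refine Finset.sum_le_sum fun x _ => Finset.sum_le_sum fun y _ => ?_
    refine mul_le_mul_of_nonneg_left ?_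
      (mul_nonneg (mul_nonneg (hu.pos x).le (hA.nonneg x y)) (hv.pos y).le)
    have hg : |g x y| ≤ C :=
      (Finset.single_le_sum (f := fun y => |g x y|) (fun y _ => abs_nonneg _)
        (Finset.mem_univ y)).trans (Finset.single_le_sum (f := fun x => ∑ y, |g x y|)
        (fun x _ => Finset.sum_nonneg fun y _ => abs_nonneg _) (Finset.mem_univ x))
    have h1 : |(b - a) * g x y| ≤ C * |b - a| := by
      rw [abs_mul, mul_comm]
      gcongr
    exact (abs_le.1 h1).1
  have := le_of_mul_le_mul_right (hlow.trans h) hpos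
  simp only [potential]
  linarith

lemma continuous_potential (hB : B.IsIrreducible) : Continuous (potential B g) := by
  refine (LipschitzWith.of_le_add_mul (∑ x, ∑ y, |g x y|).toNNReal fun a b => ?_).continuous
  have := potential_sub_le (g := g) hB a b
  rw [Real.dist_eq, abs_sub_comm, Real.coe_toNNReal _
    (Finset.sum_nonneg fun x _ => Finset.sum_nonneg fun y _ => abs_nonneg _)]
  linarith

lemma continuous_perronRoot_tilted (hB : B.IsIrreducible) :
    Continuous fun θ => perronRoot (tilted B g θ) := by
  simp_rw [← exp_potential hB]
  exact Real.continuous_exp.comp (continuous_potential hB)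

/-- Normalized right Perron vectors depend continuously on the parameter, by compactness of the
simplex and uniqueness of the Perron vector. -/
lemma tendsto_rightPerron (hB : B.IsIrreducible) {v : ℝ → X → ℝ}
    (hvs : ∀ θ, v θ ∈ stdSimplex ℝ X)
    (hv : ∀ θ, IsRightPerron (tilted B g θ) (perronRoot (tilted B g θ)) (v θ)) (a : ℝ) :
    Tendsto v (𝓝 a) (𝓝 (v a)) := by
  refine (isCompact_stdSimplex ℝ X).tendsto_nhds_of_unique_mapClusterPt
    (Eventually.of_forall hvs) fun w hw hcl => ?_
  obtain ⟨U, hU, hUw⟩ := mapClusterPt_iff_ultrafilter.1 hcl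
  refine (hv a).eq_of_mem_stdSimplex (isIrreducible_tilted hB a) (hvs a) hw fun x => ?_
  have hUw' := tendsto_pi_nhds.1 hUw
  have hA : ∀ y, Tendsto (fun θ => tilted B g θ x y) U (𝓝 (tilted B g a x y)) := fun y => by
    have : Continuous fun θ => tilted B g θ x y := by
      simp only [tilted_apply]
      fun_prop
    exact (this.tendsto a).mono_left hU
  have h1 : Tendsto (fun θ => ∑ y, tilted B g θ x y * v θ y) U (𝓝 (∑ y, tilted B g a x y * w y)) :=
    tendsto_finsetSum _ fun y _ => (hA y).mul (hUw' y)
  have h2 : Tendsto (fun θ => perronRoot (tilted B g θ) * v θ x) U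
      (𝓝 (perronRoot (tilted B g a) * w x)) :=
    (((continuous_perronRoot_tilted hB).tendsto a).mono_left hU).mul (hUw' x)
  simp only [(hv _).eigen] at h1
  exact tendsto_nhds_unique h1 h2

/-- The derivative of the potential is the average of `g` with the weights given by the Perron
vectors. It follows from `(ρ b - ρ a) * ⟪u a, v b⟫ = ⟪u a, (A b - A a) v b⟫` by letting `b → a`. -/
lemma hasDerivAt_potential (hB : B.IsIrreducible) {a : ℝ} {u v : X → ℝ}
    (hu : IsLeftPerron (tilted B g a) (perronRoot (tilted B g a)) u)
    (hv : IsRightPerron (tilted B g a) (perronRoot (tilted B g a)) v) :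
    HasDerivAt (potential B g) ((∑ x, ∑ y, u x * tilted B g a x y * v y * g x y) /
      (perronRoot (tilted B g a) * ∑ x, u x * v x)) a := by
  have hρ := perronRoot_pos (isIrreducible_tilted (g := g) hB a)
  choose w hws hw using fun θ =>
    exists_isRightPerron_mem_stdSimplex (isIrreducible_tilted (g := g) hB θ)
  -- the formula does not depend on the normalization of `v`
  obtain ⟨t, ht, hvt⟩ : ∃ t : ℝ, 0 < t ∧ v = t • w a := by
    have hS : 0 < ∑ x, v x := Finset.sum_pos (fun x _ => hv.pos x) Finset.univ_nonempty
    refine ⟨∑ x, v x, hS, ?_⟩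
    suffices h : (∑ x, v x)⁻¹ • v = w a by
      rw [← h, smul_smul, mul_inv_cancel₀ hS.ne', one_smul]
    refine (hw a).eq_of_mem_stdSimplex (isIrreducible_tilted hB a) (hws a)
      ⟨fun x => ?_, ?_⟩ fun x => ?_
    · exact mul_nonneg (inv_nonneg.2 hS.le) (hv.pos x).le
    · simp [← Finset.mul_sum, hS.ne']
    · simp only [Pi.smul_apply, smul_eq_mul, mul_left_comm _ (∑ x, v x)⁻¹, ← Finset.mul_sum,
        hv.eigen]
  have hR : HasDerivAt (fun θ => perronRoot (tilted B g θ))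
      ((∑ x, ∑ y, u x * (tilted B g a x y * g x y) * w a y) / ∑ x, u x * w a x) a := by
    rw [hasDerivAt_iff_tendsto_slope]
    have hwt := tendsto_pi_nhds.1 ((tendsto_rightPerron hB hws hw a).mono_left
      (nhdsWithin_le_nhds (s := {a}ᶜ)))
    have hAd : ∀ x y, HasDerivAt (fun θ => tilted B g θ x y) (tilted B g a x y * g x y) a := by
      intro x y
      simp only [tilted_apply]
      simpa [mul_assoc] using (((hasDerivAt_id a).mul_const (g x y)).exp).const_mul (B x y)
    have hlim : Tendsto (fun θ => (∑ x, ∑ y, u x * slope (fun θ => tilted B g θ x y) a θ * w θ y) /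
        ∑ x, u x * w θ x) (𝓝[≠] a)
        (𝓝 ((∑ x, ∑ y, u x * (tilted B g a x y * g x y) * w a y) / ∑ x, u x * w a x)) := by
      refine Tendsto.div ?_ (tendsto_finsetSum _ fun x _ => (hwt x).const_mul _)
        (hu.sum_pos (hw a).pos).ne'
      exact tendsto_finsetSum _ fun x _ => tendsto_finsetSum _ fun y _ =>
        ((hasDerivAt_iff_tendsto_slope.1 (hAd x y)).const_mul _).mul (hwt y)
    refine hlim.congr fun θ => ?_
    have h1 := hu.sum_sum (v := w θ) fun _ => 1
    have h2 := (hw θ).sum_sum (u := u) fun _ => 1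
    simp only [mul_one] at h1 h2
    rw [div_eq_iff (hu.sum_pos (hw θ).pos).ne', slope_def_field, div_mul_eq_mul_div, sub_mul,
      ← h1, ← h2]
    simp only [slope_def_field, ← Finset.sum_sub_distrib, Finset.sum_div]
    refine Finset.sum_congr rfl fun x _ => Finset.sum_congr rfl fun y _ => ?_
    ring
  have h1 := (hu.sum_pos (hw a).pos).ne'
  have h2 : ∑ x, ∑ y, u x * tilted B g a x y * v y * g x y =
      t * ∑ x, ∑ y, u x * (tilted B g a x y * g x y) * w a y := by
    simp only [hvt, Finset.mul_sum, Pi.smul_apply, smul_eq_mul]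
    exact Finset.sum_congr rfl fun x _ => Finset.sum_congr rfl fun y _ => by ring
  have h3 : ∑ x, u x * v x = t * ∑ x, u x * w a x := by
    simp only [hvt, Finset.mul_sum, Pi.smul_apply, smul_eq_mul]
    exact Finset.sum_congr rfl fun x _ => by ring
  refine (hR.log hρ.ne').congr_deriv ?_
  rw [h2, h3]
  field_simp

lemma differentiable_potential (hB : B.IsIrreducible) : Differentiable ℝ (potential B g) := by
  intro a
  have hA := isIrreducible_tilted (g := g) hB a
  obtain ⟨v, hv⟩ := exists_isRightPerron_perronRoot hA
  exact (hasDerivAt_potential hB (isLeftPerron_perronLeftVec hA) hv).differentiableAt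

/-- If the generator is a constant plus a coboundary on the support, then the tilted matrices are
conjugate up to scalars, and the potential is affine. -/
lemma potential_eq_of_coboundary (hB : B.IsIrreducible) {κ : ℝ} {h : X → ℝ}
    (hg : ∀ x y, B x y ≠ 0 → g x y = κ + h x - h y) (θ : ℝ) :
    potential B g θ = potential B g 0 + κ * θ := by
  have hu := isLeftPerron_perronLeftVec hB
  set u := perronLeftVec B
  have hρ := perronRoot_pos hB
  have h1 : IsLeftPerron (tilted B g θ) (perronRoot B * Real.exp (κ * θ))
      fun x => u x * Real.exp (-(θ * h x)) := by
    refine ⟨fun x => mul_pos (hu.pos x) (Real.exp_pos _), fun y => ?_⟩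
    have : ∀ x, u x * Real.exp (-(θ * h x)) * tilted B g θ x y =
        u x * B x y * (Real.exp (κ * θ) * Real.exp (-(θ * h y))) := by
      intro x
      by_cases hxy : B x y = 0
      · simp [tilted_apply, hxy]
      · rw [tilted_apply, hg x y hxy, ← Real.exp_add, mul_mul_mul_comm, ← Real.exp_add]
        ring_nf
    simp only [this, ← Finset.sum_mul, hu.eigen]
    ring
  rw [potential, potential, tilted_zero, h1.perronRoot_eq (isIrreducible_tilted hB θ).nonneg
    (by positivity), Real.log_mul hρ.ne' (Real.exp_ne_zero _), Real.log_exp]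

/-- The tangents of the potential lie below it. -/
lemma potential_add_deriv_mul_le (hB : B.IsIrreducible) (a b : ℝ) :
    potential B g a + deriv (potential B g) a * (b - a) ≤ potential B g b ∧
    (b ≠ a → (∀ κ, ∃ θ, potential B g θ ≠ potential B g 0 + κ * θ) →
      potential B g a + deriv (potential B g) a * (b - a) < potential B g b) := by
  have hA := isIrreducible_tilted (g := g) hB a
  have hρ := perronRoot_pos hA
  have hu := isLeftPerron_perronLeftVec hA
  obtain ⟨v, hv⟩ := exists_isRightPerron_perronRoot hA
  have hu' := isLeftPerron_perronLeftVec (isIrreducible_tilted (g := g) hB b)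
  have hρ' := perronRoot_pos (isIrreducible_tilted (g := g) hB b)
  rw [(hasDerivAt_potential hB hu hv).deriv]
  set ub := perronLeftVec (tilted B g b)
  set ρb := perronRoot (tilted B g b)
  rw [tilted_eq_of_mul_exp a b] at hu'
  have h := sum_mul_le_log_sub_log hA.nonneg hρ hρ' hu hv hu'
  set u := perronLeftVec (tilted B g a)
  have hpos := mul_pos hρ (hu.sum_pos hv.pos)
  have hrw : ∑ x, ∑ y, u x * tilted B g a x y * v y * ((b - a) * g x y) =
      (∑ x, ∑ y, u x * tilted B g a x y * v y * g x y) * (b - a) := by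
    simp only [Finset.sum_mul]
    exact Finset.sum_congr rfl fun x _ => Finset.sum_congr rfl fun y _ => by ring
  rw [hrw, ← div_le_iff₀ hpos, ← div_lt_iff₀ hpos, ← div_mul_eq_mul_div] at h
  refine ⟨by have := h.1; simp only [potential]; linarith, fun hab hna => ?_⟩
  refine lt_sub_iff_add_lt'.1 (h.2 ?_)
  by_contra! hall
  have hba : b - a ≠ 0 := sub_ne_zero.2 hab
  obtain ⟨θ, hθ⟩ := hna ((Real.log ρb - Real.log (perronRoot (tilted B g a))) / (b - a))
  refine hθ (potential_eq_of_coboundary hB (h := fun x => Real.log (u x / ub x) / (b - a))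
    (fun x y hxy => ?_) θ)
  have := hall x y ((sameSupport_tilted a x y).not.1 hxy)
  field_simp
  linarith

end Potential

/-! ### Relative entropies -/

section RelEntropy

variable {X : Type*} {W V W₀ W₁ B : Matrix X X ℝ} {g : X → X → ℝ}

/-- Off the common support one of the two powers vanishes for every exponent, because `t` and
`1 - t` are not both zero. -/
lemma of_rpow_mul_rpow_eq_tilted (hW : ∀ x y, 0 ≤ W x y) (hV : ∀ x y, 0 ≤ V x y)
    (h : SameSupport W V) (t : ℝ) :
    (Matrix.of fun x y => W x y ^ t * V x y ^ (1 - t)) = tilted V (logRatio V W) t := by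
  ext x y
  rw [Matrix.of_apply, tilted_apply, logRatio]
  by_cases h0 : V x y = 0
  · rw [(h x y).2 h0, h0, zero_mul]
    by_cases ht : t = 0
    · simp [ht]
    · rw [Real.zero_rpow ht, zero_mul]
  · have hWp := (hW x y).lt_of_ne' ((h x y).not.2 h0)
    have hVp := (hV x y).lt_of_ne' h0
    rw [Real.rpow_def_of_pos hWp, Real.rpow_sub hVp, Real.rpow_one, Real.rpow_def_of_pos hVp,
      Real.log_div hWp.ne' hVp.ne', mul_sub, Real.exp_sub, mul_comm t, mul_comm t]
    ring

lemma of_rpow_mul_rpow_eq_tilted_one_sub (hW : ∀ x y, 0 ≤ W x y) (hV : ∀ x y, 0 ≤ V x y)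
    (h : SameSupport W V) (t : ℝ) :
    (Matrix.of fun x y => W x y ^ t * V x y ^ (1 - t)) = tilted W (logRatio W V) (1 - t) := by
  rw [← of_rpow_mul_rpow_eq_tilted hV hW h.symm]
  simp [mul_comm]

lemma tilted_logRatio_one (hW : ∀ x y, 0 ≤ W x y) (hV : ∀ x y, 0 ≤ V x y) (h : SameSupport W V) :
    tilted V (logRatio V W) 1 = W := by
  rw [← of_rpow_mul_rpow_eq_tilted hW hV h]
  ext x y
  simp

variable [Fintype X] [DecidableEq X]

lemma renyiPotential_eq_potential (hW : ∀ x y, 0 ≤ W x y) (hV : ∀ x y, 0 ≤ V x y)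
    (h : SameSupport W V) : renyiPotential W V = potential V (logRatio V W) := by
  ext t
  rw [renyiPotential, of_rpow_mul_rpow_eq_tilted hW hV h, potential]

lemma renyiPotential_eq_potential_one_sub (hW : ∀ x y, 0 ≤ W x y) (hV : ∀ x y, 0 ≤ V x y)
    (h : SameSupport W V) (t : ℝ) :
    renyiPotential W V t = potential W (logRatio W V) (1 - t) := by
  rw [renyiPotential, of_rpow_mul_rpow_eq_tilted_one_sub hW hV h, potential]

lemma isLeftPerron_one (hW : W ∈ Matrix.colStochastic ℝ X) : IsLeftPerron W 1 fun _ => 1 :=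
  ⟨fun _ => one_pos, fun y => by simpa using Matrix.sum_col_of_mem_colStochastic hW y⟩

variable [Nonempty X]

lemma perronRoot_of_mem_colStochastic (hW : W ∈ Matrix.colStochastic ℝ X) : perronRoot W = 1 :=
  (isLeftPerron_one hW).perronRoot_eq (fun _ _ => Matrix.nonneg_of_mem_colStochastic hW)
    zero_le_one

/-- The relative entropy is the stationary average of the logarithmic likelihood ratio. -/
lemma relEntropy_eq (hW : W ∈ Matrix.colStochastic ℝ X) (hWi : W.IsIrreducible)
    (hV : ∀ x y, 0 ≤ V x y) (h : SameSupport W V) {p : X → ℝ} (hp : IsRightPerron W 1 p) :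
    relEntropy W V = (∑ x, ∑ y, W x y * p y * logRatio V W x y) / ∑ x, p x := by
  have h1 := tilted_logRatio_one hWi.nonneg hV h
  have hr := perronRoot_of_mem_colStochastic hW
  have := hasDerivAt_potential (h.isIrreducible hWi hV) (a := 1) (g := logRatio V W)
    (u := fun _ => 1) (v := p) (by rw [h1, hr]; exact isLeftPerron_one hW) (by rwa [h1, hr])
  rw [relEntropy, renyiPotential_eq_potential hWi.nonneg hV h, this.deriv, h1, hr]
  simp

/-- The variational inequality, applied to a transition matrix `W` and the tilted matrix. -/
lemma neg_relEntropy_add_le_potential (hW : W ∈ Matrix.colStochastic ℝ X) (hWi : W.IsIrreducible)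
    (h₀ : ∀ x y, 0 ≤ W₀ x y) (h₁ : ∀ x y, 0 ≤ W₁ x y) (hs₀ : SameSupport W W₀)
    (hs₁ : SameSupport W W₁) (θ : ℝ) :
    -((1 - θ) * relEntropy W W₀ + θ * relEntropy W W₁) ≤ potential W₀ (logRatio W₀ W₁) θ := by
  obtain ⟨p, hp⟩ := exists_isRightPerron_perronRoot hWi
  rw [perronRoot_of_mem_colStochastic hW] at hp
  have hB := isIrreducible_tilted (g := logRatio W₀ W₁) (hs₀.isIrreducible hWi h₀) θ
  have hu' := isLeftPerron_perronLeftVec hB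
  have hρ' := perronRoot_pos hB
  have hS : 0 < ∑ x, p x := Finset.sum_pos (fun x _ => hp.pos x) Finset.univ_nonempty
  set u' := perronLeftVec (tilted W₀ (logRatio W₀ W₁) θ)
  set ρ' := perronRoot (tilted W₀ (logRatio W₀ W₁) θ) with hρdef
  have hM : tilted W₀ (logRatio W₀ W₁) θ = Matrix.of fun x y =>
      W x y * Real.exp (-((1 - θ) * logRatio W₀ W x y + θ * logRatio W₁ W x y)) := by
    ext x y
    rw [Matrix.of_apply, tilted_apply]
    by_cases h0 : W x y = 0
    · rw [(hs₀ x y).1 h0, h0, zero_mul, zero_mul]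
    · have hw := (hWi.nonneg x y).lt_of_ne' h0
      have hw₀ := (h₀ x y).lt_of_ne' ((hs₀ x y).not.1 h0)
      have hw₁ := (h₁ x y).lt_of_ne' ((hs₁ x y).not.1 h0)
      simp only [logRatio]
      rw [Real.log_div hw₁.ne' hw₀.ne', Real.log_div hw.ne' hw₀.ne', Real.log_div hw.ne' hw₁.ne']
      nth_rw 1 [← Real.exp_log hw₀]
      nth_rw 1 [← Real.exp_log hw]
      rw [← Real.exp_add, ← Real.exp_add]
      ring_nf
  rw [hM] at hu'
  have key := (sum_mul_le_log_sub_log hWi.nonneg one_pos hρ' (isLeftPerron_one hW) hp hu').1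
  rw [relEntropy_eq hW hWi h₀ hs₀ hp, relEntropy_eq hW hWi h₁ hs₁ hp, potential, ← hρdef]
  refine le_of_mul_le_mul_right (le_trans (le_of_eq ?_) (key.trans (le_of_eq ?_))) hS
  · have h1 : ∑ x, ∑ y, 1 * W x y * p y *
        -((1 - θ) * logRatio W₀ W x y + θ * logRatio W₁ W x y) =
        -((1 - θ) * (∑ x, ∑ y, W x y * p y * logRatio W₀ W x y) +
          θ * ∑ x, ∑ y, W x y * p y * logRatio W₁ W x y) := by
      simp only [Finset.mul_sum, ← Finset.sum_add_distrib, ← Finset.sum_neg_distrib]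
      exact Finset.sum_congr rfl fun x _ => Finset.sum_congr rfl fun y _ => by ring
    rw [h1]
    field_simp
  · simp

/-! ### The exponential family -/

lemma sameSupport_expFamily (hB : B.IsIrreducible) (θ : ℝ) : SameSupport B (expFamily B g θ) := by
  intro x y
  have hA := isIrreducible_tilted (g := g) hB θ
  have hu := (isLeftPerron_perronLeftVec hA).pos
  rw [sameSupport_tilted (g := g) θ x y]
  simp [expFamily, (perronRoot_pos hA).ne', (hu x).ne', (hu y).ne']

lemma expFamily_mem_colStochastic (hB : B.IsIrreducible) (θ : ℝ) :
    expFamily B g θ ∈ Matrix.colStochastic ℝ X := by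
  have hA := isIrreducible_tilted (g := g) hB θ
  have hu := isLeftPerron_perronLeftVec hA
  have hρ := perronRoot_pos hA
  rw [Matrix.mem_colStochastic_iff_sum]
  refine ⟨fun x y => ?_, fun y => ?_⟩
  · exact mul_nonneg (mul_nonneg (mul_nonneg (inv_nonneg.2 hρ.le) (hu.pos x).le) (hA.nonneg x y))
      (inv_nonneg.2 (hu.pos y).le)
  · have hy := hu.pos y
    simp only [expFamily, Matrix.of_apply, mul_assoc, ← Finset.mul_sum]
    rw [Finset.sum_congr rfl fun x _ => (mul_assoc _ _ _).symm, ← Finset.sum_mul, hu.eigen]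
    field_simp

/-- The matrix that defines the relative Rényi entropy between a member of the family and a tilted
matrix is, up to a scalar and a conjugation, again a tilted matrix. -/
lemma renyiPotential_expFamily (hB : B.IsIrreducible) (θ c t : ℝ) :
    renyiPotential (expFamily B g θ) (tilted B g c) t =
      potential B g (t * θ + (1 - t) * c) - t * potential B g θ := by
  have hA := isIrreducible_tilted (g := g) hB θ
  have hu := isLeftPerron_perronLeftVec hA
  have hρ := perronRoot_pos hA
  have hA' := isIrreducible_tilted (g := g) hB (t * θ + (1 - t) * c)
  have hu' := isLeftPerron_perronLeftVec hA'
  have hρ' := perronRoot_pos hA'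
  set u := perronLeftVec (tilted B g θ)
  set u' := perronLeftVec (tilted B g (t * θ + (1 - t) * c))
  have hentry : ∀ x y, expFamily B g θ x y ^ t * tilted B g c x y ^ (1 - t) =
      Real.exp (-(t * potential B g θ)) * (u x ^ t * tilted B g (t * θ + (1 - t) * c) x y *
        (u y ^ t)⁻¹) := by
    intro x y
    by_cases h0 : B x y = 0
    · rw [(sameSupport_expFamily hB θ x y).1 h0, (sameSupport_tilted c x y).1 h0,
        (sameSupport_tilted _ x y).1 h0]
      by_cases ht : t = 0
      · simp [ht]
      · simp [Real.zero_rpow ht]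
    · have hb := (hB.nonneg x y).lt_of_ne' h0
      have hx := hu.pos x
      have hy := hu.pos y
      have hE : expFamily B g θ x y = Real.exp (-potential B g θ + Real.log (u x) +
          (Real.log (B x y) + θ * g x y) - Real.log (u y)) := by
        rw [Real.exp_sub, Real.exp_add, Real.exp_add, Real.exp_neg, exp_potential hB,
          Real.exp_log hx, Real.exp_log hy, Real.exp_add, Real.exp_log hb]
        rfl
      have hT : ∀ s, tilted B g s x y = Real.exp (Real.log (B x y) + s * g x y) := by
        intro s
        rw [Real.exp_add, Real.exp_log hb, tilted_apply]
      rw [hE, hT, hT, ← Real.exp_mul, ← Real.exp_mul, Real.rpow_def_of_pos hx,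
        Real.rpow_def_of_pos hy, ← Real.exp_neg]
      simp only [← Real.exp_add]
      ring_nf
  have hleft : IsLeftPerron
      (Matrix.of fun x y => expFamily B g θ x y ^ t * tilted B g c x y ^ (1 - t))
      (Real.exp (-(t * potential B g θ)) * perronRoot (tilted B g (t * θ + (1 - t) * c)))
      fun x => u' x * (u x ^ t)⁻¹ := by
    refine ⟨fun x => mul_pos (hu'.pos x) (inv_pos.2 (Real.rpow_pos_of_pos (hu.pos x) t)),
      fun y => ?_⟩
    calc ∑ x, u' x * (u x ^ t)⁻¹ * (Matrix.of fun x y =>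
          expFamily B g θ x y ^ t * tilted B g c x y ^ (1 - t)) x y
        = ∑ x, u' x * tilted B g (t * θ + (1 - t) * c) x y *
          (Real.exp (-(t * potential B g θ)) * (u y ^ t)⁻¹) := by
          refine Finset.sum_congr rfl fun x _ => ?_
          rw [Matrix.of_apply, hentry]
          have := Real.rpow_pos_of_pos (hu.pos x) t
          field_simp
      _ = _ := by
          rw [← Finset.sum_mul, hu'.eigen]
          ring
  rw [renyiPotential, hleft.perronRoot_eq (fun x y => ?_) (by positivity),
    Real.log_mul (Real.exp_ne_zero _) hρ'.ne', Real.log_exp]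
  · simp only [potential]
    ring
  · exact mul_nonneg (Real.rpow_nonneg (Matrix.nonneg_of_mem_colStochastic
      (expFamily_mem_colStochastic hB θ)) _)
      (Real.rpow_nonneg ((isIrreducible_tilted hB c).nonneg x y) _)

lemma relEntropy_expFamily (hB : B.IsIrreducible) (θ c : ℝ) :
    relEntropy (expFamily B g θ) (tilted B g c) =
      (θ - c) * deriv (potential B g) θ - potential B g θ := by
  have h1 : renyiPotential (expFamily B g θ) (tilted B g c) =
      fun t => potential B g (t * θ + (1 - t) * c) - t * potential B g θ :=
    funext fun t => renyiPotential_expFamily hB θ c t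
  have h2 : HasDerivAt (fun t : ℝ => t * θ + (1 - t) * c) (θ - c) 1 := by
    refine (((hasDerivAt_id (1 : ℝ)).mul_const θ).add
      (((hasDerivAt_id (1 : ℝ)).const_sub 1).mul_const c)).congr_deriv ?_
    ring
  have h3 : HasDerivAt (potential B g) (deriv (potential B g) θ)
      ((fun t : ℝ => t * θ + (1 - t) * c) 1) := by
    simpa using (differentiable_potential hB θ).hasDerivAt
  have h4 := (h3.comp 1 h2).sub ((hasDerivAt_id (1 : ℝ)).mul_const (potential B g θ))
  rw [relEntropy, h1]
  refine (HasDerivAt.deriv h4).trans ?_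
  ring

end RelEntropy

/-! ### Sums over the paths of a Markov chain -/

section Paths

variable {X : Type*} {W V : Matrix X X ℝ} {P Q : X → ℝ}

lemma pathLaw_nonneg (hW : ∀ x y, 0 ≤ W x y) (hP : ∀ x, 0 ≤ P x) (n : ℕ) (x : Fin (n + 1) → X) :
    0 ≤ pathLaw W P n x :=
  mul_nonneg (hP _) (Finset.prod_nonneg fun _ _ => hW _ _)

lemma pathLaw_rpow_mul_rpow (hW : ∀ x y, 0 ≤ W x y) (hP : ∀ x, 0 ≤ P x) (hV : ∀ x y, 0 ≤ V x y)
    (hQ : ∀ x, 0 ≤ Q x) (s t : ℝ) (n : ℕ) (x : Fin (n + 1) → X) :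
    pathLaw W P n x ^ s * pathLaw V Q n x ^ t =
      pathLaw (Matrix.of fun x y => W x y ^ s * V x y ^ t) (fun x => P x ^ s * Q x ^ t) n x := by
  simp only [pathLaw, Matrix.of_apply, Finset.prod_mul_distrib]
  rw [Real.mul_rpow (hP _) (Finset.prod_nonneg fun _ _ => hW _ _),
    Real.mul_rpow (hQ _) (Finset.prod_nonneg fun _ _ => hV _ _),
    Real.finsetProd_rpow _ _ (fun _ _ => hW _ _), Real.finsetProd_rpow _ _ (fun _ _ => hV _ _)]
  ring

variable [Fintype X]

/-- A left eigenvector, evaluated at the last state, makes the path sums geometric in `n`. -/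
lemma sum_pathLaw_mul {c : ℝ} {u : X → ℝ} (hu : IsLeftPerron W c u) (n : ℕ) :
    ∑ x, pathLaw W P n x * u (x (Fin.last n)) = c ^ n * ∑ x, P x * u x := by
  induction n with
  | zero =>
    rw [pow_zero, one_mul]
    refine Fintype.sum_equiv (Equiv.funUnique (Fin 1) X) _ _ fun x => ?_
    simp [pathLaw]
  | succ n ih =>
    rw [← (Fin.snocEquiv fun _ : Fin (n + 2) => X).sum_comp, Fintype.sum_prod_type_right, pow_succ',
      mul_assoc, ← ih, Finset.mul_sum]
    refine Finset.sum_congr rfl fun x _ => ?_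
    have h : ∀ a : X, pathLaw W P (n + 1) (Fin.snoc (α := fun _ => X) x a) =
        pathLaw W P n x * W a (x (Fin.last n)) := by
      intro a
      simp only [pathLaw]
      rw [Fin.prod_univ_castSucc]
      simp only [← Fin.castSucc_zero, Fin.snoc_castSucc, Fin.succ_castSucc, Fin.succ_last,
        Fin.snoc_last, mul_assoc]
    simp only [Fin.snocEquiv, Equiv.coe_fn_mk, h, Fin.snoc_last]
    rw [mul_left_comm, ← hu.eigen, Finset.mul_sum]
    exact Finset.sum_congr rfl fun a _ => by ring

variable [DecidableEq X]

lemma sum_pathLaw_eq_one (hW : W ∈ Matrix.colStochastic ℝ X) (hP : P ∈ stdSimplex ℝ X) (n : ℕ) :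
    ∑ x, pathLaw W P n x = 1 := by
  simpa [hP.2] using sum_pathLaw_mul (P := P) (isLeftPerron_one hW) n

/-- The Rényi sums of two path laws grow at most like the powers of the Perron eigenvalue. -/
lemma exists_sum_pathLaw_rpow_le [Nonempty X] (hW : W.IsIrreducible) (hV : ∀ x y, 0 ≤ V x y)
    (h : SameSupport W V) (hP : ∀ x, 0 ≤ P x) (hQ : ∀ x, 0 ≤ Q x) (t : ℝ) :
    ∃ C > 0, ∀ n : ℕ, ∑ x, pathLaw W P n x ^ t * pathLaw V Q n x ^ (1 - t) ≤
      C * Real.exp (n * renyiPotential W V t) := by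
  set M : Matrix X X ℝ := Matrix.of fun x y => W x y ^ t * V x y ^ (1 - t) with hM
  have hMi : M.IsIrreducible := by
    rw [hM, of_rpow_mul_rpow_eq_tilted hW.nonneg hV h]
    exact isIrreducible_tilted (h.isIrreducible hW hV) t
  have hu := isLeftPerron_perronLeftVec hMi
  set u := perronLeftVec M
  set R : X → ℝ := fun x => P x ^ t * Q x ^ (1 - t) with hR
  have hR0 : ∀ x, 0 ≤ R x := fun x =>
    mul_nonneg (Real.rpow_nonneg (hP x) _) (Real.rpow_nonneg (hQ x) _)
  obtain ⟨m, -, hm⟩ := Finset.exists_min_image Finset.univ u Finset.univ_nonempty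
  have hexp : ∀ n : ℕ, Real.exp (n * renyiPotential W V t) = perronRoot M ^ n := fun n => by
    rw [Real.exp_nat_mul, renyiPotential, Real.exp_log (perronRoot_pos hMi)]
  have hnn : 0 ≤ ∑ x, R x * u x :=
    Finset.sum_nonneg fun x _ => mul_nonneg (hR0 x) (hu.pos x).le
  refine ⟨(∑ x, R x * u x) / u m + 1, by have := hu.pos m; positivity, fun n => ?_⟩
  have hρ := perronRoot_pos hMi
  rw [hexp]
  calc ∑ x, pathLaw W P n x ^ t * pathLaw V Q n x ^ (1 - t) = ∑ x, pathLaw M R n x :=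
        Finset.sum_congr rfl fun x _ => pathLaw_rpow_mul_rpow hW.nonneg hP hV hQ t (1 - t) n x
    _ ≤ ∑ x, pathLaw M R n x * u (x (Fin.last n)) / u m := by
        refine Finset.sum_le_sum fun x _ => ?_
        rw [le_div_iff₀ (hu.pos m)]
        exact mul_le_mul_of_nonneg_left (hm _ (Finset.mem_univ _))
          (pathLaw_nonneg hMi.nonneg hR0 n x)
    _ = ((∑ x, R x * u x) / u m) * perronRoot M ^ n := by
        rw [← Finset.sum_div, sum_pathLaw_mul hu]
        ring
    _ ≤ _ := by
        gcongr
        linarith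

end Paths

/-! ### Bounds for a single hypothesis test -/

section Test

variable {Ω : Type*} [Fintype Ω] {Q Q₀ Q₁ : Ω → ℝ} {ε : ℝ}

lemma betaRandomized_le_betaDeterministic (hQ₀ : ∀ ω, 0 ≤ Q₀ ω) (hsum : ∑ ω, Q₀ ω = 1)
    (hε : 0 ≤ ε) : betaRandomized ε Q₁ Q₀ ≤ betaDeterministic ε Q₁ Q₀ := by
  classical
  refine csInf_le_csInf ⟨0, ?_⟩ ⟨1, ∅, by simpa using hε, by simp⟩ ?_
  · rintro b ⟨T, hT, -, rfl⟩
    exact Finset.sum_nonneg fun ω _ => mul_nonneg (hQ₀ ω) (sub_nonneg.2 (hT ω).2)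
  · rintro b ⟨S, hS, rfl⟩
    refine ⟨fun ω => if ω ∈ S then 1 else 0, fun ω => ?_, ?_, ?_⟩
    · dsimp only
      split_ifs <;> norm_num
    · simpa [Finset.sum_ite_mem] using hS
    · simp [mul_sub, hsum, Finset.sum_ite_mem]

/-- The test that rejects where `Q₁ ≤ κ * Q₀`. There `Q₁`, and elsewhere `κ * Q₀`, is the smaller of
the two and thus at most `Q₁ ^ θ * (κ * Q₀) ^ (1 - θ)`. -/
lemma betaDeterministic_le {κ θ : ℝ} (hQ₀ : ∀ ω, 0 ≤ Q₀ ω) (hQ₁ : ∀ ω, 0 ≤ Q₁ ω)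
    (hsum : ∑ ω, Q₀ ω = 1) (hκ : 0 < κ) (hθ : θ ∈ Set.Ioo 0 1)
    (hε : κ ^ (1 - θ) * ∑ ω, Q₀ ω ^ (1 - θ) * Q₁ ω ^ θ ≤ ε) :
    betaDeterministic ε Q₁ Q₀ ≤ ε / κ := by
  classical
  obtain ⟨h0, h1⟩ := hθ
  have hmin : ∀ ω, min (Q₁ ω) (κ * Q₀ ω) ≤ κ ^ (1 - θ) * (Q₀ ω ^ (1 - θ) * Q₁ ω ^ θ) := by
    intro ω
    have hk : 0 ≤ κ * Q₀ ω := mul_nonneg hκ.le (hQ₀ ω)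
    have hm : 0 ≤ min (Q₁ ω) (κ * Q₀ ω) := le_min (hQ₁ ω) hk
    calc min (Q₁ ω) (κ * Q₀ ω)
        = min (Q₁ ω) (κ * Q₀ ω) ^ θ * min (Q₁ ω) (κ * Q₀ ω) ^ (1 - θ) := by
          rw [← Real.rpow_add_of_nonneg hm h0.le (by linarith)]
          simp
      _ ≤ Q₁ ω ^ θ * (κ * Q₀ ω) ^ (1 - θ) := by
          exact mul_le_mul (Real.rpow_le_rpow hm (min_le_left _ _) h0.le)
            (Real.rpow_le_rpow hm (min_le_right _ _) (by linarith)) (Real.rpow_nonneg hm _)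
            (Real.rpow_nonneg (hQ₁ ω) _)
      _ = _ := by rw [Real.mul_rpow hκ.le (hQ₀ ω)]; ring
  have hnn : ∀ ω, 0 ≤ κ ^ (1 - θ) * (Q₀ ω ^ (1 - θ) * Q₁ ω ^ θ) := fun ω => by
    have := hQ₀ ω
    have := hQ₁ ω
    positivity
  rw [Finset.mul_sum] at hε
  set S : Finset Ω := Finset.univ.filter fun ω => Q₁ ω ≤ κ * Q₀ ω with hS
  have hbdd : BddBelow {b : ℝ | ∃ S : Finset Ω, ∑ ω ∈ S, Q₁ ω ≤ ε ∧ b = 1 - ∑ ω ∈ S, Q₀ ω} := by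
    refine ⟨0, ?_⟩
    rintro b ⟨S, -, rfl⟩
    rw [sub_nonneg, ← hsum]
    exact Finset.sum_le_sum_of_subset_of_nonneg (Finset.subset_univ _) fun ω _ _ => hQ₀ ω
  refine (csInf_le hbdd ⟨S, ?_, rfl⟩).trans ?_
  · refine le_trans (Finset.sum_le_sum fun ω hω => ?_) ((Finset.sum_le_sum_of_subset_of_nonneg
      (Finset.subset_univ S) fun ω _ _ => hnn ω).trans hε)
    have := hmin ω
    rwa [min_eq_left (Finset.mem_filter.1 hω).2] at this
  · rw [le_div_iff₀ hκ, ← hsum, ← Finset.sum_sdiff (Finset.subset_univ S), add_sub_cancel_right,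
      Finset.sum_mul]
    refine le_trans (Finset.sum_le_sum fun ω hω => ?_) ((Finset.sum_le_sum_of_subset_of_nonneg
      (Finset.subset_univ _) fun ω _ _ => hnn ω).trans hε)
    have hω' : ¬ Q₁ ω ≤ κ * Q₀ ω := by simpa [hS] using hω
    have := hmin ω
    rwa [min_eq_right (not_le.1 hω').le, mul_comm κ] at this

lemma betaDeterministic_le_one (hQ₀ : ∀ ω, 0 ≤ Q₀ ω) (hsum : ∑ ω, Q₀ ω = 1) (hε : 0 ≤ ε) :
    betaDeterministic ε Q₁ Q₀ ≤ 1 := by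
  refine csInf_le ⟨0, ?_⟩ ⟨∅, by simpa using hε, by simp⟩
  rintro b ⟨S, -, rfl⟩
  rw [sub_nonneg, ← hsum]
  exact Finset.sum_le_sum_of_subset_of_nonneg (Finset.subset_univ _) fun ω _ _ => hQ₀ ω

/-- Markov's inequality for the likelihood ratio, as a pointwise bound. -/
lemma le_mul_add_rpow {q q' c s : ℝ} (hq : 0 ≤ q) (hq' : 0 ≤ q') (hc : 0 < c) (hs : 0 < s)
    (h : q' = 0 → q = 0) :
    q ≤ c * q' + c ^ (-s) * (q ^ (1 + s) * q' ^ (1 - (1 + s))) := by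
  rcases le_or_gt q (c * q') with hle | hlt
  · have : 0 ≤ c ^ (-s) * (q ^ (1 + s) * q' ^ (1 - (1 + s))) := by positivity
    linarith
  · rcases hq'.eq_or_lt with h0 | hpos
    · rw [h h0.symm, ← h0] at hlt
      simp at hlt
    · have hqp : 0 < q := (mul_pos hc hpos).trans hlt
      have h1 : 1 ≤ (q / (c * q')) ^ s :=
        Real.one_le_rpow ((one_le_div (mul_pos hc hpos)).2 hlt.le) hs.le
      have h2 : c ^ (-s) * (q ^ (1 + s) * q' ^ (1 - (1 + s))) = q * (q / (c * q')) ^ s := by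
        rw [Real.div_rpow hq (by positivity), Real.mul_rpow hc.le hq', Real.rpow_add hqp,
          show 1 - (1 + s) = -s by ring, Real.rpow_neg hc.le, Real.rpow_neg hq', Real.rpow_one]
        field_simp
      have h3 : q ≤ q * (q / (c * q')) ^ s := le_mul_of_one_le_right hq h1
      have h4 : 0 ≤ c * q' := by positivity
      linarith

/-- Converse bound by change of measure: under an auxiliary law `Q` one of the two error
probabilities has to be large. -/
lemma one_le_betaRandomized {c₀ c₁ s₀ s₁ : ℝ} (hQ : ∀ ω, 0 ≤ Q ω) (hQ₀ : ∀ ω, 0 ≤ Q₀ ω)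
    (hQ₁ : ∀ ω, 0 ≤ Q₁ ω) (hsum : ∑ ω, Q ω = 1) (h0 : ∀ ω, Q₀ ω = 0 → Q ω = 0)
    (h1 : ∀ ω, Q₁ ω = 0 → Q ω = 0) (hc₀ : 0 < c₀) (hc₁ : 0 < c₁) (hs₀ : 0 < s₀) (hs₁ : 0 < s₁)
    (hε : 0 ≤ ε) :
    1 ≤ c₁ * ε + c₁ ^ (-s₁) * ∑ ω, Q ω ^ (1 + s₁) * Q₁ ω ^ (1 - (1 + s₁)) +
      c₀ ^ (-s₀) * ∑ ω, Q ω ^ (1 + s₀) * Q₀ ω ^ (1 - (1 + s₀)) +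
      c₀ * betaRandomized ε Q₁ Q₀ := by
  set M₁ := c₁ ^ (-s₁) * ∑ ω, Q ω ^ (1 + s₁) * Q₁ ω ^ (1 - (1 + s₁)) with hM₁
  set M₀ := c₀ ^ (-s₀) * ∑ ω, Q ω ^ (1 + s₀) * Q₀ ω ^ (1 - (1 + s₀)) with hM₀
  rw [← sub_le_iff_le_add', ← div_le_iff₀' hc₀]
  refine le_csInf ⟨_, 0, by simp, by simpa using hε, rfl⟩ ?_
  rintro b ⟨T, hT, hTε, rfl⟩
  rw [div_le_iff₀' hc₀]
  have hA : ∑ ω, Q ω * T ω ≤ c₁ * ε + M₁ := by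
    calc ∑ ω, Q ω * T ω ≤ ∑ ω, (c₁ * (Q₁ ω * T ω) +
          c₁ ^ (-s₁) * (Q ω ^ (1 + s₁) * Q₁ ω ^ (1 - (1 + s₁)))) := by
          refine Finset.sum_le_sum fun ω _ => ?_
          have hp := le_mul_add_rpow (hQ ω) (hQ₁ ω) hc₁ hs₁ (h1 ω)
          have hr : 0 ≤ c₁ ^ (-s₁) * (Q ω ^ (1 + s₁) * Q₁ ω ^ (1 - (1 + s₁))) := by
            have := hQ ω
            have := hQ₁ ω
            positivity
          have h2 := mul_le_mul_of_nonneg_right hp (hT ω).1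
          have h3 := mul_le_of_le_one_right hr (hT ω).2
          linarith
      _ ≤ c₁ * ε + M₁ := by
          rw [Finset.sum_add_distrib, ← Finset.mul_sum, ← Finset.mul_sum]
          gcongr
  have hB : ∑ ω, Q ω * (1 - T ω) ≤ c₀ * (∑ ω, Q₀ ω * (1 - T ω)) + M₀ := by
    rw [hM₀, Finset.mul_sum, Finset.mul_sum, ← Finset.sum_add_distrib]
    refine Finset.sum_le_sum fun ω _ => ?_
    have hp := le_mul_add_rpow (hQ ω) (hQ₀ ω) hc₀ hs₀ (h0 ω)
    have hr : 0 ≤ c₀ ^ (-s₀) * (Q ω ^ (1 + s₀) * Q₀ ω ^ (1 - (1 + s₀))) := by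
      have := hQ ω
      have := hQ₀ ω
      positivity
    have h2 := mul_le_mul_of_nonneg_right hp (sub_nonneg.2 (hT ω).2)
    have h3 := mul_le_of_le_one_right hr (sub_le_self 1 (hT ω).1)
    linarith
  have hC : ∑ ω, Q ω * T ω + ∑ ω, Q ω * (1 - T ω) = 1 := by
    rw [← Finset.sum_add_distrib]
    exact (Finset.sum_congr rfl fun ω _ => by
      rw [← mul_add, add_sub_cancel, mul_one]).trans hsum
  linarith

end Test

/-! ### Exponential rates -/

section Rates

/-- Exponential bounds determine the rate; the lower bound also excludes `log 0 = 0`. -/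
lemma tendsto_neg_inv_mul_log {b : ℕ → ℝ} {C E : ℝ} (hC : 0 < C)
    (hup : ∀ n : ℕ, b n ≤ C * Real.exp (-(n * E)))
    (hlow : ∀ a, E < a → ∀ᶠ n : ℕ in atTop, Real.exp (-(n * a)) / 2 ≤ b n) :
    Tendsto (fun n : ℕ => -(1 / (n : ℝ)) * Real.log (b n)) atTop (𝓝 E) := by
  have hlim : ∀ a c : ℝ, Tendsto (fun n : ℕ => a + c / (n : ℝ)) atTop (𝓝 a) := fun a c => by
    simpa using tendsto_const_nhds.add (tendsto_const_div_atTop_nhds_zero_nat c)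
  refine tendsto_order.2 ⟨fun a ha => ?_, fun a ha => ?_⟩
  · filter_upwards [hlow (E + 1) (by linarith), eventually_gt_atTop 0,
      (tendsto_order.1 (hlim E (-Real.log C))).1 a ha] with n hn hn0 hna
    have hb : 0 < b n := lt_of_lt_of_le (by positivity) hn
    have hn0' : (0 : ℝ) < n := Nat.cast_pos.2 hn0
    have h1 := Real.log_le_log hb (hup n)
    rw [Real.log_mul hC.ne' (Real.exp_ne_zero _), Real.log_exp] at h1
    refine hna.trans_le ?_
    rw [show E + -Real.log C / n = -(1 / (n : ℝ)) * (Real.log C + -(n * E)) by field_simp; ring]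
    exact mul_le_mul_of_nonpos_left h1 (by simp)
  · obtain ⟨d, hd, hda⟩ := exists_between ha
    filter_upwards [hlow d hd, eventually_gt_atTop 0,
      (tendsto_order.1 (hlim d (Real.log 2))).2 a hda] with n hn hn0 hna
    have hn0' : (0 : ℝ) < n := Nat.cast_pos.2 hn0
    have h1 := Real.log_le_log (by positivity) hn
    rw [Real.log_div (Real.exp_ne_zero _) two_ne_zero, Real.log_exp] at h1
    refine lt_of_le_of_lt ?_ hna
    rw [show d + Real.log 2 / n = -(1 / (n : ℝ)) * (-(n * d) - Real.log 2) by field_simp; ring]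
    exact mul_le_mul_of_nonpos_left h1 (by simp)

variable {X : Type*} [Fintype X] [DecidableEq X] [Nonempty X] {W W₀ W₁ : Matrix X X ℝ}
  {P₀ P₁ : X → ℝ}

lemma tendsto_const_mul_exp_neg {c : ℝ} (C : ℝ) (hc : 0 < c) :
    Tendsto (fun n : ℕ => C * Real.exp (-(n * c))) atTop (𝓝 0) := by
  have h : Tendsto (fun n : ℕ => (n : ℝ) * c) atTop atTop :=
    tendsto_natCast_atTop_atTop.atTop_mul_const hc
  simpa using (Real.tendsto_exp_neg_atTop_nhds_zero.comp h).const_mul C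

/-- Achievability: the threshold of the likelihood ratio test is chosen such that the constraint on
the first error probability holds. -/
lemma exists_betaDeterministic_le (hW₀ : W₀ ∈ Matrix.colStochastic ℝ X) (hW₀i : W₀.IsIrreducible)
    (hW₁ : ∀ x y, 0 ≤ W₁ x y) (h : SameSupport W₀ W₁) (hP₀ : P₀ ∈ stdSimplex ℝ X)
    (hP₁ : ∀ x, 0 ≤ P₁ x) {θ : ℝ} (hθ : θ ∈ Set.Ioo (0 : ℝ) 1) (r : ℝ) :
    ∃ C > 0, ∀ n : ℕ, betaDeterministic (Real.exp (-(n * r))) (pathLaw W₁ P₁ n) (pathLaw W₀ P₀ n) ≤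
      C * Real.exp (-(n * ((-θ * r - renyiPotential W₀ W₁ (1 - θ)) / (1 - θ)))) := by
  obtain ⟨C, hC, hsum⟩ := exists_sum_pathLaw_rpow_le hW₀i hW₁ h hP₀.1 hP₁ (1 - θ)
  set ψ := renyiPotential W₀ W₁ (1 - θ)
  have hθ1 : 0 < 1 - θ := sub_pos.2 hθ.2
  refine ⟨Real.exp (Real.log C / (1 - θ)), Real.exp_pos _, fun n => ?_⟩
  refine (betaDeterministic_le (κ := Real.exp (-(n * (r + ψ) + Real.log C) / (1 - θ)))
    (pathLaw_nonneg hW₀i.nonneg hP₀.1 n) (pathLaw_nonneg hW₁ hP₁ n) (sum_pathLaw_eq_one hW₀ hP₀ n)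
    (Real.exp_pos _) hθ ?_).trans (le_of_eq ?_)
  · have h1 := hsum n
    rw [sub_sub_cancel] at h1
    rw [← Real.exp_mul, div_mul_cancel₀ _ hθ1.ne']
    refine (mul_le_mul_of_nonneg_left h1 (Real.exp_pos _).le).trans (le_of_eq ?_)
    nth_rw 2 [← Real.exp_log hC]
    rw [← Real.exp_add, ← Real.exp_add]
    ring_nf
  · rw [← Real.exp_sub, ← Real.exp_add]
    congr 1
    field_simp
    ring

/-- Converse: if an auxiliary chain `W` is closer to `W₁` than the prescribed rate `r`, then its
divergence from `W₀` bounds the exponent. The auxiliary chain starts in a state that both initial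
distributions charge. -/
lemma eventually_le_betaRandomized (hW : W ∈ Matrix.colStochastic ℝ X) (hWi : W.IsIrreducible)
    (hW₀ : ∀ x y, 0 ≤ W₀ x y) (hW₁ : ∀ x y, 0 ≤ W₁ x y) (h₀ : SameSupport W W₀)
    (h₁ : SameSupport W W₁) (hP₀ : ∀ x, 0 ≤ P₀ x) (hP₁ : ∀ x, 0 ≤ P₁ x)
    (hP : ∃ x, P₀ x ≠ 0 ∧ P₁ x ≠ 0) {a₀ a₁ s₀ s₁ r : ℝ} (hs₀ : 0 < s₀) (hs₁ : 0 < s₁)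
    (ha₀ : renyiPotential W W₀ (1 + s₀) < s₀ * a₀) (ha₁ : renyiPotential W W₁ (1 + s₁) < s₁ * a₁)
    (hr : a₁ < r) :
    ∀ᶠ n : ℕ in atTop, Real.exp (-(n * a₀)) / 2 ≤
      betaRandomized (Real.exp (-(n * r))) (pathLaw W₁ P₁ n) (pathLaw W₀ P₀ n) := by
  obtain ⟨z, hz₀, hz₁⟩ := hP
  set P : X → ℝ := Pi.single z 1 with hPdef
  have hPn : ∀ x, 0 ≤ P x := fun x => by
    rw [hPdef, Pi.single_apply]
    split_ifs <;> norm_num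
  have hPs : P ∈ stdSimplex ℝ X := ⟨hPn, by simp [hPdef]⟩
  have habs : ∀ (V : Matrix X X ℝ) (R : X → ℝ), SameSupport W V → R z ≠ 0 → ∀ (n : ℕ) x,
      pathLaw V R n x = 0 → pathLaw W P n x = 0 := by
    intro V R hV hR n x h0
    rcases mul_eq_zero.1 h0 with h0 | h0
    · have hx : x 0 ≠ z := fun hx => hR (hx ▸ h0)
      simp [pathLaw, hPdef, hx]
    · obtain ⟨i, hi, h0⟩ := Finset.prod_eq_zero_iff.1 h0
      exact mul_eq_zero_of_right _ (Finset.prod_eq_zero hi ((hV _ _).2 h0))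
  obtain ⟨C₀, -, hC₀⟩ := exists_sum_pathLaw_rpow_le hWi hW₀ h₀ hPn hP₀ (1 + s₀)
  obtain ⟨C₁, -, hC₁⟩ := exists_sum_pathLaw_rpow_le hWi hW₁ h₁ hPn hP₁ (1 + s₁)
  set R₀ := renyiPotential W W₀ (1 + s₀)
  set R₁ := renyiPotential W W₁ (1 + s₁)
  have hlim : Tendsto (fun n : ℕ => 1 * Real.exp (-(n * (r - a₁))) +
      C₁ * Real.exp (-(n * (s₁ * a₁ - R₁))) + C₀ * Real.exp (-(n * (s₀ * a₀ - R₀)))) atTop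
      (𝓝 (0 + 0 + 0)) :=
    ((tendsto_const_mul_exp_neg 1 (sub_pos.2 hr)).add
      (tendsto_const_mul_exp_neg C₁ (sub_pos.2 ha₁))).add
      (tendsto_const_mul_exp_neg C₀ (sub_pos.2 ha₀))
  have hmul : ∀ (n : ℕ) (a s C R S : ℝ), S ≤ C * Real.exp (n * R) →
      Real.exp (n * a) ^ (-s) * S ≤ C * Real.exp (-(n * (s * a - R))) := by
    intro n a s C R S hS
    rw [← Real.exp_mul]
    refine (mul_le_mul_of_nonneg_left hS (Real.exp_pos _).le).trans (le_of_eq ?_)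
    rw [mul_left_comm, ← Real.exp_add]
    ring_nf
  filter_upwards [(tendsto_order.1 hlim).2 (1 / 2) (by norm_num)] with n hn
  have key := one_le_betaRandomized (ε := Real.exp (-(n * r))) (c₀ := Real.exp (n * a₀))
    (c₁ := Real.exp (n * a₁)) (pathLaw_nonneg hWi.nonneg hPn n) (pathLaw_nonneg hW₀ hP₀ n)
    (pathLaw_nonneg hW₁ hP₁ n) (sum_pathLaw_eq_one hW hPs n) (habs W₀ P₀ h₀ hz₀ n)
    (habs W₁ P₁ h₁ hz₁ n) (Real.exp_pos _) (Real.exp_pos _) hs₀ hs₁ (Real.exp_pos _).le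
  have e0 := hmul n a₀ s₀ C₀ R₀ _ (hC₀ n)
  have e1 := hmul n a₁ s₁ C₁ R₁ _ (hC₁ n)
  have e2 : Real.exp (n * a₁) * Real.exp (-(n * r)) = 1 * Real.exp (-(n * (r - a₁))) := by
    rw [← Real.exp_add, one_mul]
    ring_nf
  rw [Real.exp_neg, div_le_iff₀ two_pos, inv_le_iff_one_le_mul₀' (Real.exp_pos _)]
  linarith

end Rates

/-! ### Legendre-type calculus of a convex potential -/

section Convex

variable {φ : ℝ → ℝ} {r t : ℝ}

lemma exists_pos_lt_mul {G : ℝ → ℝ} {G' a : ℝ} (hG : HasDerivAt G G' 0) (h0 : G 0 = 0)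
    (ha : G' < a) : ∃ s > 0, G s < s * a := by
  have h := (hasDerivAt_iff_tendsto_slope.1 hG).mono_left
    (nhdsWithin_mono 0 fun s (hs : s ∈ Set.Ioi 0) => ne_of_gt hs)
  obtain ⟨s, hs, hs0⟩ := ((h.eventually_lt_const ha).and self_mem_nhdsWithin).exists
  refine ⟨s, hs0, ?_⟩
  rwa [slope_def_field, h0, sub_zero, sub_zero, div_lt_iff₀' hs0] at hs

/-- The first-order behaviour at `s = 0` of the function that gives `s * D_{1+s}` for a member of
the exponential family and the member with parameter `c`. -/
lemma exists_pos_potential_lt {c a θ : ℝ} (hd : Differentiable ℝ φ)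
    (ha : (θ - c) * deriv φ θ - φ θ < a) :
    ∃ s > 0, φ ((1 + s) * θ + (1 - (1 + s)) * c) - (1 + s) * φ θ < s * a := by
  refine exists_pos_lt_mul (G := fun s => φ ((1 + s) * θ + (1 - (1 + s)) * c) - (1 + s) * φ θ)
    (G' := (θ - c) * deriv φ θ - φ θ) ?_ (by simp) ha
  have h1 : HasDerivAt (fun s : ℝ => 1 + s) 1 0 := (hasDerivAt_id (0 : ℝ)).const_add 1
  have h2 : HasDerivAt (fun s : ℝ => (1 + s) * θ + (1 - (1 + s)) * c) (θ - c) 0 := by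
    refine ((h1.mul_const θ).add ((h1.const_sub 1).mul_const c)).congr_deriv ?_
    ring
  have h3 : HasDerivAt φ (deriv φ θ) ((fun s : ℝ => (1 + s) * θ + (1 - (1 + s)) * c) 0) := by
    simpa using (hd θ).hasDerivAt
  refine ((h3.comp 0 h2).sub (h1.mul_const (φ θ))).congr_deriv ?_
  ring

lemma deriv_le_deriv_of_tangent (htan : ∀ a b, φ a + deriv φ a * (b - a) ≤ φ b) {a b : ℝ}
    (hab : a < b) : deriv φ a ≤ deriv φ b := by
  have h1 := htan a b
  have h2 := htan b a
  refine le_of_mul_le_mul_right ?_ (sub_pos.2 hab)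
  linarith

/-- To the left of `1`, the function `(θ - 1) * φ' θ - φ θ` is strictly decreasing: it is the value
at `1` of the tangent at `θ`, with the opposite sign. -/
lemma sub_one_mul_deriv_sub_lt (htan : ∀ a b, φ a + deriv φ a * (b - a) ≤ φ b)
    (hstrict : ∀ a b, b ≠ a → φ a + deriv φ a * (b - a) < φ b) {a b : ℝ} (hab : a < b)
    (hb : b ≤ 1) : (b - 1) * deriv φ b - φ b < (a - 1) * deriv φ a - φ a := by
  have h1 := hstrict a b hab.ne'
  have h2 := mul_nonneg (sub_nonneg.2 hb) (sub_nonneg.2 (deriv_le_deriv_of_tangent htan hab))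
  linarith

/-- Existence of a solution, by Darboux's theorem for a primitive of `(θ - 1) * φ' θ - φ θ`. -/
lemma exists_mem_thetaSolutions (hd : Differentiable ℝ φ) (h0 : φ 0 = 0) (h1 : φ 1 = 0)
    (hr : 0 < r) (hrD : r ≤ -deriv φ 0) : ∃ θ ∈ Set.Ico (0 : ℝ) 1, θ ∈ thetaSolutions φ r := by
  have hG : ∀ θ, HasDerivAt (fun θ => (θ - 1) * φ θ - 2 * ∫ x in (0 : ℝ)..θ, φ x)
      ((θ - 1) * deriv φ θ - φ θ) θ := by
    intro θ
    have hint := hd.continuous.integral_hasStrictDerivAt 0 θ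
    refine ((((hasDerivAt_id θ).sub_const 1).mul (hd θ).hasDerivAt).sub
      (hint.hasDerivAt.const_mul 2)).congr_deriv ?_
    simp only [id]
    ring
  obtain ⟨θ, hθ, hθr⟩ := ((Set.ordConnected_Icc (a := (0 : ℝ)) (b := 1)).image_hasDerivWithinAt
    fun θ _ => (hG θ).hasDerivWithinAt).out
    (Set.mem_image_of_mem _ (Set.right_mem_Icc.2 zero_le_one))
    (Set.mem_image_of_mem _ (Set.left_mem_Icc.2 zero_le_one))
    (show r ∈ Set.Icc _ _ from ⟨by simpa [h1] using hr.le, by simpa [h0] using hrD⟩)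
  refine ⟨θ, ⟨hθ.1, hθ.2.lt_of_ne ?_⟩, hθr⟩
  rintro rfl
  simp [h1, hr.ne] at hθr

lemma isLeast_thetaSolutions (htan : ∀ a b, φ a + deriv φ a * (b - a) ≤ φ b)
    (hstrict : ∀ a b, b ≠ a → φ a + deriv φ a * (b - a) < φ b) (ht : t ∈ thetaSolutions φ r)
    (ht1 : t < 1) : IsLeast (thetaSolutions φ r) t := by
  refine ⟨ht, fun θ hθ => not_lt.1 fun hlt => ?_⟩
  have := sub_one_mul_deriv_sub_lt htan hstrict hlt ht1.le
  rw [thetaSolutions, Set.mem_ofPred_eq] at ht hθ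
  linarith

lemma neg_mul_sub_div_le (htan : ∀ a b, φ a + deriv φ a * (b - a) ≤ φ b)
    (ht : t ∈ thetaSolutions φ r) {θ : ℝ} (hθ : θ < 1) :
    (-θ * r - φ θ) / (1 - θ) ≤ t * deriv φ t - φ t := by
  rw [div_le_iff₀ (sub_pos.2 hθ)]
  have ht' : (t - 1) * deriv φ t - φ t = r := ht
  linear_combination htan t θ + θ * ht'

lemma neg_mul_sub_div_eq (ht : t ∈ thetaSolutions φ r) (ht1 : t < 1) :
    (-t * r - φ t) / (1 - t) = t * deriv φ t - φ t := by
  rw [div_eq_iff (sub_pos.2 ht1).ne']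
  have ht' : (t - 1) * deriv φ t - φ t = r := ht
  linear_combination t * ht'

lemma isLUB_neg_mul_sub_div (htan : ∀ a b, φ a + deriv φ a * (b - a) ≤ φ b)
    (ht : t ∈ thetaSolutions φ r) (ht01 : t ∈ Set.Ico (0 : ℝ) 1) :
    IsLUB ((fun θ : ℝ => (-θ * r - φ θ) / (1 - θ)) '' Set.Ico 0 1) (t * deriv φ t - φ t) := by
  refine IsGreatest.isLUB ⟨⟨t, ht01, neg_mul_sub_div_eq ht ht01.2⟩, ?_⟩
  rintro _ ⟨θ, hθ, rfl⟩
  exact neg_mul_sub_div_le htan ht hθ.2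

end Convex

end MarkovHT

open MarkovHT in
theorem mainTheorem11 {X : Type*} [Fintype X] [DecidableEq X]
    (W₀ W₁ : Matrix X X ℝ)
    (hW₀ : MarkovHT.IsErgodicTransition W₀) (hW₁ : MarkovHT.IsErgodicTransition W₁)
    (hsupp : MarkovHT.SameSupport W₀ W₁)
    (P₀ P₁ : X → ℝ) (hP₀ : P₀ ∈ stdSimplex ℝ X) (hP₁ : P₁ ∈ stdSimplex ℝ X)
    (hP : ∃ x, P₀ x ≠ 0 ∧ P₁ x ≠ 0)
    (r : ℝ) (hr : 0 < r) (hrD : r ≤ MarkovHT.relEntropy W₀ W₁)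
    -- the potential `φ`, the exponential family `Wθ`, the parameter `θr` and the exponent `E`
    (φ : ℝ → ℝ) (hφ : φ = MarkovHT.potential W₀ (MarkovHT.logRatio W₀ W₁))
    (Wθ : ℝ → Matrix X X ℝ) (hWθ : Wθ = MarkovHT.expFamily W₀ (MarkovHT.logRatio W₀ W₁))
    (θr : ℝ) (hθr : θr = MarkovHT.thetaHat φ r)
    (E : ℝ) (hE : E = MarkovHT.relEntropy (Wθ θr) W₀) :
    -- the parameter is well defined
    IsLeast (MarkovHT.thetaSolutions φ r) θr ∧ 0 ≤ θr ∧ θr < 1 ∧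
    MarkovHT.relEntropy (Wθ θr) W₁ = r ∧
    -- the exponent, for randomized and for deterministic tests
    Tendsto (fun n : ℕ => -(1 / (n : ℝ)) *
        Real.log (MarkovHT.betaRandomized (Real.exp (-(n * r)))
          (MarkovHT.pathLaw W₁ P₁ n) (MarkovHT.pathLaw W₀ P₀ n))) atTop (𝓝 E) ∧
    Tendsto (fun n : ℕ => -(1 / (n : ℝ)) *
        Real.log (MarkovHT.betaDeterministic (Real.exp (-(n * r)))
          (MarkovHT.pathLaw W₁ P₁ n) (MarkovHT.pathLaw W₀ P₀ n))) atTop (𝓝 E) ∧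
    -- the other expressions for the exponent
    IsLUB ((fun θ : ℝ => (-θ * r - φ θ) / (1 - θ)) '' Set.Ico 0 1) E ∧
    IsLUB ((fun θ : ℝ => θ * (-r + MarkovHT.renyiRelEntropy (-θ) W₀ W₁) / (1 - θ)) ''
        Set.Ico 0 1) E ∧
    IsGLB {d : ℝ | ∃ s θ : ℝ, 0 < s ∧ θ ∈ Set.Ioo θr 1 ∧
        d = MarkovHT.renyiRelEntropy s (Wθ θ) W₀} E ∧
    IsLeast ((fun W : Matrix X X ℝ => MarkovHT.relEntropy W W₀) ''
        {W | MarkovHT.IsErgodicTransition W ∧ MarkovHT.SameSupport W W₀ ∧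
          MarkovHT.relEntropy W W₁ ≤ r}) E := by
  obtain ⟨z, hz⟩ := id hP
  have : Nonempty X := ⟨z⟩
  have hB := hW₀.irreducible
  have h₀ := hB.nonneg
  have h₁ := hW₁.irreducible.nonneg
  have ht1 : tilted W₀ (logRatio W₀ W₁) 1 = W₁ := tilted_logRatio_one h₁ h₀ hsupp.symm
  have ht0 : tilted W₀ (logRatio W₀ W₁) 0 = W₀ := tilted_zero
  -- the potential and its properties
  have hd : Differentiable ℝ φ := hφ ▸ differentiable_potential hB
  have hφ0 : φ 0 = 0 := by
    rw [hφ, potential, ht0, perronRoot_of_mem_colStochastic hW₀.stochastic, Real.log_one]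
  have hφ1 : φ 1 = 0 := by
    rw [hφ, potential, ht1, perronRoot_of_mem_colStochastic hW₁.stochastic, Real.log_one]
  have hpot : ∀ t, renyiPotential W₀ W₁ t = φ (1 - t) := fun t => by
    rw [hφ, renyiPotential_eq_potential_one_sub h₀ h₁ hsupp]
  have hD : relEntropy W₀ W₁ = -deriv φ 0 := by
    rw [relEntropy, funext hpot, deriv_comp_const_sub, sub_self]
  rw [hD] at hrD
  have htan : ∀ a b, φ a + deriv φ a * (b - a) ≤ φ b := fun a b =>
    hφ ▸ (potential_add_deriv_mul_le hB a b).1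
  -- an affine potential would vanish at `0` and `1`, hence everywhere, against `φ' 0 ≤ -r < 0`
  have hna : ∀ κ, ∃ θ, φ θ ≠ φ 0 + κ * θ := by
    intro κ
    by_contra! hall
    have hκ : κ = 0 := by
      have := hall 1
      rw [hφ0, hφ1] at this
      linarith
    have hφc : φ = fun _ => 0 := funext fun θ => by rw [hall θ, hφ0, hκ]; ring
    rw [hφc, deriv_const] at hrD
    linarith
  have hstrict : ∀ a b, b ≠ a → φ a + deriv φ a * (b - a) < φ b := by
    rw [hφ] at hna ⊢
    exact fun a b hab => (potential_add_deriv_mul_le hB a b).2 hab hna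
  -- the entropies of the members of the family
  have hren₀ : ∀ θ t, renyiPotential (Wθ θ) W₀ t = φ (t * θ + (1 - t) * 0) - t * φ θ := by
    intro θ t
    have := renyiPotential_expFamily (g := logRatio W₀ W₁) hB θ 0 t
    rwa [ht0, ← hWθ, ← hφ] at this
  have hren₁ : ∀ θ t, renyiPotential (Wθ θ) W₁ t = φ (t * θ + (1 - t) * 1) - t * φ θ := by
    intro θ t
    have := renyiPotential_expFamily (g := logRatio W₀ W₁) hB θ 1 t
    rwa [ht1, ← hWθ, ← hφ] at this
  have hrel₀ : ∀ θ, relEntropy (Wθ θ) W₀ = θ * deriv φ θ - φ θ := by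
    intro θ
    have := relEntropy_expFamily (g := logRatio W₀ W₁) hB θ 0
    rwa [ht0, ← hWθ, ← hφ, sub_zero] at this
  have hrel₁ : ∀ θ, relEntropy (Wθ θ) W₁ = (θ - 1) * deriv φ θ - φ θ := by
    intro θ
    have := relEntropy_expFamily (g := logRatio W₀ W₁) hB θ 1
    rwa [ht1, ← hWθ, ← hφ] at this
  have hWs : ∀ θ, Wθ θ ∈ Matrix.colStochastic ℝ X := fun θ =>
    hWθ ▸ expFamily_mem_colStochastic hB θ
  have hWS : ∀ θ, SameSupport W₀ (Wθ θ) := fun θ => hWθ ▸ sameSupport_expFamily hB θ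
  have hWe : ∀ θ, IsErgodicTransition (Wθ θ) := fun θ => hW₀.of_sameSupport (hWS θ) (hWs θ)
  -- the parameter
  obtain ⟨θ', hθ', hsol⟩ := exists_mem_thetaSolutions hd hφ0 hφ1 hr hrD
  have hleast := isLeast_thetaSolutions htan hstrict hsol hθ'.2
  obtain rfl : θr = θ' := hθr.trans hleast.csInf_eq
  obtain ⟨hθ0, hθ1⟩ := hθ'
  have hsol' : (θr - 1) * deriv φ θr - φ θr = r := hsol
  rw [hrel₀] at hE
  have hlub : IsLUB ((fun θ : ℝ => (-θ * r - φ θ) / (1 - θ)) '' Set.Ico 0 1) E :=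
    hE ▸ isLUB_neg_mul_sub_div htan hsol ⟨hθ0, hθ1⟩
  -- slightly to the right of `θr`, some `D_{1+s}(Wθ ‖ W₀)` is close to `E`
  have hnear : ∀ a, E < a → ∃ s > 0, ∃ θ ∈ Set.Ioo θr 1,
      renyiPotential (Wθ θ) W₀ (1 + s) < s * a := by
    intro a ha
    obtain ⟨s, hs, hlt⟩ := exists_pos_potential_lt (c := 0) (θ := θr) (a := a) hd
      (by rw [sub_zero, ← hE]; exact ha)
    have hc : Continuous fun θ => φ ((1 + s) * θ + (1 - (1 + s)) * 0) - (1 + s) * φ θ := by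
      have := hd.continuous
      fun_prop
    obtain ⟨θ, hθ, hθI⟩ := (((hc.tendsto θr).mono_left nhdsWithin_le_nhds).eventually_lt_const
      hlt |>.and (Ioo_mem_nhdsGT hθ1)).exists
    exact ⟨s, hs, θ, hθI, by rwa [hren₀]⟩
  -- bounds for the error probabilities
  have hlow : ∀ a, E < a → ∀ᶠ n : ℕ in atTop, Real.exp (-(n * a)) / 2 ≤
      betaRandomized (Real.exp (-(n * r))) (pathLaw W₁ P₁ n) (pathLaw W₀ P₀ n) := by
    intro a ha
    obtain ⟨s₀, hs₀, θ, hθ, hlt₀⟩ := hnear a ha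
    have hltr := sub_one_mul_deriv_sub_lt htan hstrict hθ.1 hθ.2.le
    rw [hsol'] at hltr
    -- `D(Wθ ‖ W₁)` is less than `r` at `θ > θr`, which leaves room for the threshold rate `a₁`
    obtain ⟨a₁, ha₁, ha₁r⟩ := exists_between hltr
    obtain ⟨s₁, hs₁, hlt₁⟩ := exists_pos_potential_lt (c := 1) hd ha₁
    rw [← hren₁] at hlt₁
    exact eventually_le_betaRandomized (hWs θ) (hWe θ).irreducible h₀ h₁ (hWS θ).symm
      (fun x y => ((hWS θ) x y).symm.trans (hsupp x y)) hP₀.1 hP₁.1 hP hs₀ hs₁ hlt₀ hlt₁ ha₁r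
  have hRD : ∀ n : ℕ, betaRandomized (Real.exp (-(n * r))) (pathLaw W₁ P₁ n) (pathLaw W₀ P₀ n) ≤
      betaDeterministic (Real.exp (-(n * r))) (pathLaw W₁ P₁ n) (pathLaw W₀ P₀ n) := fun n =>
    betaRandomized_le_betaDeterministic (pathLaw_nonneg h₀ hP₀.1 n)
      (sum_pathLaw_eq_one hW₀.stochastic hP₀ n) (Real.exp_pos _).le
  obtain ⟨C, hC, hup⟩ : ∃ C > 0, ∀ n : ℕ, betaDeterministic (Real.exp (-(n * r)))
      (pathLaw W₁ P₁ n) (pathLaw W₀ P₀ n) ≤ C * Real.exp (-(n * E)) := by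
    rcases hθ0.eq_or_lt with h | hpos
    -- for `θr = 0` the exponent is zero, and the test that never rejects is good enough
    · refine ⟨1, one_pos, fun n => ?_⟩
      have hE0 : E = 0 := by rw [hE, ← h, hφ0]; ring
      simpa [hE0] using betaDeterministic_le_one (pathLaw_nonneg h₀ hP₀.1 n)
        (sum_pathLaw_eq_one hW₀.stochastic hP₀ n) (Real.exp_pos (-(n * r))).le
    · have := exists_betaDeterministic_le hW₀.stochastic hB h₁ hsupp hP₀ hP₁.1 ⟨hpos, hθ1⟩ r
      rwa [hpot, sub_sub_cancel, neg_mul_sub_div_eq hsol hθ1, ← hE] at this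
  refine ⟨hleast, hθ0, hθ1, (hrel₁ θr).trans hsol',
    tendsto_neg_inv_mul_log hC (fun n => (hRD n).trans (hup n)) hlow,
    tendsto_neg_inv_mul_log hC hup fun a ha => (hlow a ha).mono fun n hn => hn.trans (hRD n),
    hlub, ?_, ⟨?_, fun b hb => not_lt.1 fun hlt => ?_⟩, ?_, ?_⟩
  · convert hlub using 1
    refine Set.image_congr fun θ _ => ?_
    by_cases h : θ = 0
    · simp [h, hφ0]
    · rw [renyiRelEntropy, if_neg (neg_ne_zero.2 h), hpot]
      field_simp
      ring_nf
  · rintro d ⟨s, θ, hs, hθ, rfl⟩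
    rw [renyiRelEntropy, if_neg hs.ne', hren₀, le_div_iff₀ hs, hE]
    have e1 := mul_le_mul_of_nonneg_left (htan θ θr) hs.le
    have e2 := htan θ ((1 + s) * θ + (1 - (1 + s)) * 0)
    have e3 := mul_nonneg (mul_nonneg hs.le hθ0)
      (sub_nonneg.2 (deriv_le_deriv_of_tangent htan hθ.1))
    linear_combination e1 + e2 + e3
  · obtain ⟨s, hs, θ, hθ, h⟩ := hnear b hlt
    have := hb ⟨s, θ, hs, hθ, rfl⟩
    rw [renyiRelEntropy, if_neg hs.ne', le_div_iff₀' hs] at this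
    linarith
  · exact ⟨Wθ θr, ⟨hWe θr, (hWS θr).symm, ((hrel₁ θr).trans hsol').le⟩, (hrel₀ θr).trans hE.symm⟩
  · rintro _ ⟨W, ⟨hW, hWS₀, hWr⟩, rfl⟩
    have hv := neg_relEntropy_add_le_potential hW.stochastic hW.irreducible h₀ h₁ hWS₀
      (fun x y => (hWS₀ x y).trans (hsupp x y)) θr
    rw [← hφ] at hv
    have hm := mul_le_mul_of_nonneg_left hWr hθ0
    rw [hE, ← neg_mul_sub_div_eq hsol hθ1, div_le_iff₀ (sub_pos.2 hθ1)]
    dsimp only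
    linarith
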